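/- Work in propositional logic with the connectives $\to,\wedge,\vee,\bot$ and variables $p_0,p_1,\dots$, with $p=p_0$ and $q=p_1$. An intermediate logic is a set of formulas that contains intuitionistic logic, is contained in classical logic and is closed under modus ponens and uniform substitution. Define $$\beta_{-1}=p,\quad \gamma_{-1}=q,\quad \beta_0=q\to p,\quad \gamma_0=p\to q,$$ $$\beta_{n+1}=\gamma_n\to(\beta_n\vee\gamma_{n-1}),\quad \gamma_{n+1}=\beta_n\to(\gamma_n\vee\beta_{n-1}),\quad \alpha_n=(\beta_{n+2}\wedge\gamma_{n+2})\to(\beta_{n+1}\vee\gamma_{n+1})\quad(n\ge 0),$$ $$\delta=\big(\alpha_0\to(\alpha_1\vee\alpha_2)\big)\to(\alpha_0\vee\alpha_1),\qquad \kappa=\alpha_1\to(\alpha_0\vee\beta_2),$$ $$\mathbf{bb}_2=\bigwedge_{i=0}^{2}\Big(\big(p_i\to\bigvee_{j\ne i}p_j\big)\to\bigvee_{j\ne i}p_j\Big)\to\bigvee_{i=0}^{2}p_i .$$ For $n\in\omega$ let $\mathcal F_n$ be the finite partially ordered set with the $2n+6$ points $r,s,b_0,\dots,b_{n+1},c_0,\dots,c_{n+1}$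 in which $r$ is the least element, $s$ lies below all points except $r$, and $b_i\le b_j\iff c_i\le c_j\iff j\le i$ and $b_i\le c_j\iff c_i\le b_j\iff j+2\le i$, with no further relations. The Jankov formula $J(F)$ of a finite poset $F$ with least element $\hat 0$ has one variable $p_a$ for each $a\in F$ (these are identified with distinct variables of the language by an enumeration of $F$). With $\Gamma_a=\bigwedge_{a\not\le c}p_c$ it is $$J(F)=\Big(\bigwedge_{a\le b}\big((\Gamma_b\to p_b)\to p_a\big)\wedge\bigwedge_{d}\Big(\bigwedge_{a\notin{\uparrow}d}(\Gamma_a\to p_a)\to\bigvee_{a\in d}p_a\Big)\wedge\Big(\bigwedge_{a\in F}(\Gamma_a\to p_a)\to\bot\Big)\Big)\to p_{\hat 0},$$ where $d$ ranges over the antichains of $F$ with at least two elements, ${\uparrow}d$ is the set of points that lie above some point of $d$. For $S\subseteq\omega$ let $L_S$ be the logic axiomatized over intuitionistic logic (with modus ponens and uniform substitution) by $\delta$, $\kappa$, $\mathbf{bb}_2$ and the formulas $J(\mathcal F_n)$ with $n\in S$. Theorem. Every $L_S$ is an intermediate logic. If $S\ne T$ then $L_S\ne L_T$, so the set $\{L_S: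 S\subseteq\omega\}$ has the cardinality of the continuum. Every $L_S$ is Kripke-incomplete: there is no class of partially ordered sets (Kripke frames) such that $L_S$ is the set of all formulas that are true in all frames of the class. -/

import Mathlib

universe u

/-- Propositional formulas over a set `α` of variables, with the intuitionistic primitives. -/
inductive Form (α : Type) : Type
  | var : α → Form α
  | bot : Form α
  | and : Form α → Form α → Form α
  | or : Form α → Form α → Form α
  | imp : Form α → Form α → Form α

namespace Form

infixr:55 " ⟶ᵢ " => Form.imp
infixr:60 " ∨ᵢ " => Form.or
infixr:65 " ∧ᵢ " => Form.and

/-- Uniform substitution of formulas for variables. -/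
def subst {α β : Type} (σ : α → Form β) : Form α → Form β
  | var a => σ a
  | bot => bot
  | and φ ψ => and (subst σ φ) (subst σ ψ)
  | or φ ψ => or (subst σ φ) (subst σ ψ)
  | imp φ ψ => imp (subst σ φ) (subst σ ψ)

/-- Finite conjunction; the empty one is `⊥ → ⊥`. -/
def conj {α : Type} : List (Form α) → Form α
  | [] => bot ⟶ᵢ bot
  | φ :: l => φ ∧ᵢ conj l

/-- Finite disjunction; the empty one is `⊥`. -/
def disj {α : Type} : List (Form α) → Form α
  | [] => bot
  | φ :: l => φ ∨ᵢ disj l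

/-- Truth value of a formula under a classical (two-valued) valuation. -/
def classicalEval {α : Type} (v : α → Prop) : Form α → Prop
  | var a => v a
  | bot => False
  | and φ ψ => classicalEval v φ ∧ classicalEval v ψ
  | or φ ψ => classicalEval v φ ∨ classicalEval v ψ
  | imp φ ψ => classicalEval v φ → classicalEval v ψ

/-- Intuitionistic truth of a formula at a point of a partially ordered set `W`
under the valuation `V`. -/
def forces {α : Type} {W : Type*} [PartialOrder W] (V : α → Set W) : W → Form α → Prop
  | w, var a => w ∈ V a
  | _, bot => False
  | w, and φ ψ => forces V w φ ∧ forces V w ψ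
  | w, or φ ψ => forces V w φ ∨ forces V w ψ
  | w, imp φ ψ => ∀ v, w ≤ v → forces V v φ → forces V v ψ

/-- `φ` is true in the Kripke frame `W`: it is true at all points under all valuations of the
variables by upward closed sets. -/
def ValidIn {α : Type} (W : Type*) [PartialOrder W] (φ : Form α) : Prop :=
  ∀ V : α → Set W, (∀ a, IsUpperSet (V a)) → ∀ w, forces V w φ

end Form

open Form

/-- Derivability from the axioms of intuitionistic propositional logic and the additional axioms
in `Γ` by modus ponens and uniform substitution. -/
inductive Derivable (Γ : Set (Form ℕ)) : Form ℕ → Prop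
  | ax {φ} : φ ∈ Γ → Derivable Γ φ
  | imp_k (φ ψ) : Derivable Γ (φ ⟶ᵢ ψ ⟶ᵢ φ)
  | imp_s (φ ψ χ) : Derivable Γ ((φ ⟶ᵢ ψ ⟶ᵢ χ) ⟶ᵢ (φ ⟶ᵢ ψ) ⟶ᵢ φ ⟶ᵢ χ)
  | and_left (φ ψ) : Derivable Γ (φ ∧ᵢ ψ ⟶ᵢ φ)
  | and_right (φ ψ) : Derivable Γ (φ ∧ᵢ ψ ⟶ᵢ ψ)
  | and_intro (φ ψ) : Derivable Γ (φ ⟶ᵢ ψ ⟶ᵢ φ ∧ᵢ ψ)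
  | or_left (φ ψ) : Derivable Γ (φ ⟶ᵢ φ ∨ᵢ ψ)
  | or_right (φ ψ) : Derivable Γ (ψ ⟶ᵢ φ ∨ᵢ ψ)
  | or_elim (φ ψ χ) : Derivable Γ ((φ ⟶ᵢ χ) ⟶ᵢ (ψ ⟶ᵢ χ) ⟶ᵢ φ ∨ᵢ ψ ⟶ᵢ χ)
  | bot_elim (φ) : Derivable Γ (bot ⟶ᵢ φ)
  | mp {φ ψ} : Derivable Γ (φ ⟶ᵢ ψ) → Derivable Γ φ → Derivable Γ ψ
  | subst {φ} (σ : ℕ → Form ℕ) : Derivable Γ φ → Derivable Γ (φ.subst σ)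

/-- The logic axiomatized over intuitionistic logic by `Γ`. -/
def logicOf (Γ : Set (Form ℕ)) : Set (Form ℕ) := {φ | Derivable Γ φ}

/-- Intuitionistic propositional logic. -/
def intLogic : Set (Form ℕ) := logicOf ∅

/-- Classical propositional logic. -/
def classicalLogic : Set (Form ℕ) := {φ | ∀ v : ℕ → Prop, classicalEval v φ}

/-- Intermediate logics: sets of formulas between intuitionistic and classical logic that are
closed under modus ponens and uniform substitution. -/
structure IsIntermediateLogic (L : Set (Form ℕ)) : Prop where
  int_subset : intLogic ⊆ L
  subset_classical : L ⊆ classicalLogic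
  mp : ∀ φ ψ : Form ℕ, (φ ⟶ᵢ ψ) ∈ L → φ ∈ L → ψ ∈ L
  subst : ∀ (φ : Form ℕ) (σ : ℕ → Form ℕ), φ ∈ L → φ.subst σ ∈ L

/-- A logic is (Kripke) complete if it is the set of all formulas that are true in all frames of
some class of Kripke frames. -/
def KripkeComplete (L : Set (Form ℕ)) : Prop :=
  ∃ C : Set PartOrd.{u}, ∀ φ : Form ℕ, φ ∈ L ↔ ∀ W ∈ C, ValidIn W φ

/-- The Gabbay-de Jongh formulas. -/
def bb (n : ℕ) : Form ℕ :=
  let others (i : ℕ) : Form ℕ := disj (((List.range (n + 1)).filter (fun j => j ≠ i)).map var)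
  conj ((List.range (n + 1)).map fun i => (var i ⟶ᵢ others i) ⟶ᵢ others i) ⟶ᵢ
    disj ((List.range (n + 1)).map var)

/-- The pairs `(β_{n-1}, γ_{n-1})` of Shehtman's formulas in the variables `p = var 0`
and `q = var 1`. -/
def betaGamma : ℕ → Form ℕ × Form ℕ
  | 0 => (var 0, var 1)
  | 1 => (var 1 ⟶ᵢ var 0, var 0 ⟶ᵢ var 1)
  | n + 2 =>
    ((betaGamma (n + 1)).2 ⟶ᵢ (betaGamma (n + 1)).1 ∨ᵢ (betaGamma n).2,
      (betaGamma (n + 1)).1 ⟶ᵢ (betaGamma (n + 1)).2 ∨ᵢ (betaGamma n).1)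

/-- `β_n` for `n ≥ 0`. -/
def shBeta (n : ℕ) : Form ℕ := (betaGamma (n + 1)).1

/-- `γ_n` for `n ≥ 0`. -/
def shGamma (n : ℕ) : Form ℕ := (betaGamma (n + 1)).2

def shAlpha (n : ℕ) : Form ℕ :=
  shBeta (n + 2) ∧ᵢ shGamma (n + 2) ⟶ᵢ shBeta (n + 1) ∨ᵢ shGamma (n + 1)

def shEta : Form ℕ := shAlpha 0 ⟶ᵢ shAlpha 1 ∨ᵢ shAlpha 2

def shEpsilon : Form ℕ := shAlpha 0 ∨ᵢ shAlpha 1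

def shDelta : Form ℕ := shEta ⟶ᵢ shEpsilon

def shKappa : Form ℕ := shAlpha 1 ⟶ᵢ shAlpha 0 ∨ᵢ shBeta 2

/-- Two descending columns with `n + 2` points each; level `0` is the top. -/
@[ext]
structure Ladder (n : ℕ) where
  side : Bool
  level : Fin (n + 2)
  deriving DecidableEq, Fintype

/-- A point lies below the points of its own column that are not on a lower level, and below the
points of the other column that are at least two levels higher. -/
instance (n : ℕ) : PartialOrder (Ladder n) where
  le a b := (a.side = b.side ∧ (b.level : ℕ) ≤ a.level) ∨ (b.level : ℕ) + 2 ≤ a.level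
  le_refl a := Or.inl ⟨rfl, le_rfl⟩
  le_trans a b c h k := by
    rcases h with ⟨h, h'⟩ | h <;> rcases k with ⟨k, k'⟩ | k
    · exact Or.inl ⟨h.trans k, k'.trans h'⟩
    all_goals exact Or.inr (by omega)
  le_antisymm a b h k := by
    rcases h with ⟨h, h'⟩ | h <;> rcases k with ⟨k, k'⟩ | k
    · exact Ladder.ext h (Fin.ext (le_antisymm k' h'))
    all_goals exact absurd h (by omega)

/-- The frame `F_n`: the ladder with two further points added below it, one below the other. -/
abbrev SeqFrame (n : ℕ) : Type := WithBot (WithBot (Ladder n))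

open scoped Classical in
/-- The Jankov formula of a finite rooted frame `F`, written with the points of `F` as variables:
with `D` the set of all antichains of `F` with at least two points, it is
`(⋀_{a ≤ b} ψ_{a,b} ∧ ⋀_{d ∈ D} ψ_d ∧ ψ_⊥) → p_⊥`, where, for `Γ_a = ⋀_{¬ a ≤ c} p_c`,
`ψ_{a,b} = (Γ_b → p_b) → p_a`, `ψ_d = ⋀_{a ∉ ↑d} (Γ_a → p_a) → ⋁_{a ∈ d} p_a` and
`ψ_⊥ = ⋀_a (Γ_a → p_a) → ⊥`. -/
noncomputable def jankovForm (F : Type) [PartialOrder F] [OrderBot F] [Fintype F] : Form F :=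
  let step (a : F) : Form F :=
    conj (({c | ¬ a ≤ c} : Finset F).toList.map var) ⟶ᵢ var a
  let arrow (x : F × F) : Form F := step x.2 ⟶ᵢ var x.1
  let closed (d : Finset F) : Form F :=
    conj (({a | ∀ b ∈ d, ¬ b ≤ a} : Finset F).toList.map step) ⟶ᵢ disj (d.toList.map var)
  conj (({x | x.1 ≤ x.2} : Finset (F × F)).toList.map arrow) ∧ᵢ
    conj (({d | IsAntichain (· ≤ ·) (d : Set F) ∧ 2 ≤ d.card} :
      Finset (Finset F)).toList.map closed) ∧ᵢ
    (conj ((Finset.univ : Finset F).toList.map step) ⟶ᵢ bot) ⟶ᵢ var ⊥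

/-- The Jankov formula of `F` in the variables `0, 1, 2, …`, for an enumeration of `F`. -/
noncomputable def jankov (F : Type) [PartialOrder F] [OrderBot F] [Fintype F] : Form ℕ :=
  (jankovForm F).subst fun a => var (Fintype.equivFin F a : ℕ)

/-- The logic axiomatized by `δ`, `κ`, `bb₂` and the Jankov formulas of the frames `F_n`
with `n ∈ S`. -/
noncomputable def shLogic (S : Set ℕ) : Set (Form ℕ) :=
  logicOf ({shDelta, shKappa, bb 2} ∪ (fun n => jankov (SeqFrame n)) '' S)

/-! Incompleteness: `shEpsilon`, that is α_0 ∨ α_1, holds in every Kripke frame of the axioms but is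
not derivable. By δ and κ, the indices n of the α_n refuted at a point form the empty set, a
singleton or a final segment of ℕ (`gap_trichotomy`). So a point refuting α_0 and α_1 refutes every
α_n. Above a refutation of α_n there is a point refuting α_n alone; sorting such points by n mod 3
gives three upper sets that refute bb₂ (`validIn_shEpsilon`).

In a general frame these three sets may be missing. On `Comb`, sets with almost all or almost no
teeth cannot split the teeth into three infinite classes, so bb₂ survives while `spine 0` refutes
`shEpsilon`. Soundness is used at single points, so it does not matter that Jankov formulas fail at
feet.

Distinctness: the cone of `foot n` is F_n and refutes J(F_n), whereas J(F_n) is true at every other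
point of `Comb`. Hence for n ∉ S all axioms of L_S are true at `foot n`.

Both halves rest on one computation. A valuation on `Comb` refuting some α_k has a definite shape on
the ladder around a level s, up to exchanging p and q (`exists_pattern`), and then α_k fails exactly
below `tooth (s + k)` (`Pattern.notMem_gap_iff`). -/

namespace Form

/-! ### Kripke semantics -/

section Semantics

variable {α β : Type} {W : Type*} [PartialOrder W]

theorem forces_mono {V : α → Set W} (hV : ∀ a, IsUpperSet (V a)) (φ : Form α) :
    ∀ {w v : W}, w ≤ v → forces V w φ → forces V v φ := by
  induction φ with
  | var a => exact fun h hw => hV a h hw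
  | bot => exact fun _ hw => hw
  | and φ ψ ihφ ihψ => exact fun h hw => ⟨ihφ h hw.1, ihψ h hw.2⟩
  | or φ ψ ihφ ihψ => exact fun h hw => hw.imp (ihφ h) (ihψ h)
  | imp φ ψ _ _ => exact fun h hw u hu => hw u (h.trans hu)

theorem forces_subst (V : β → Set W) (σ : α → Form β) (φ : Form α) :
    ∀ w : W, forces V w (φ.subst σ) ↔ forces (fun a => {v | forces V v (σ a)}) w φ := by
  induction φ with
  | var a => exact fun _ => Iff.rfl
  | bot => exact fun _ => Iff.rfl
  | and φ ψ ihφ ihψ => exact fun w => and_congr (ihφ w) (ihψ w)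
  | or φ ψ ihφ ihψ => exact fun w => or_congr (ihφ w) (ihψ w)
  | imp φ ψ ihφ ihψ =>
    exact fun w => forall_congr' fun v => imp_congr_right fun _ => imp_congr (ihφ v) (ihψ v)

theorem forces_conj (V : α → Set W) (w : W) (l : List (Form α)) :
    forces V w (conj l) ↔ ∀ φ ∈ l, forces V w φ := by
  induction l with
  | nil => simp [conj, forces]
  | cons φ l ih => simp [conj, forces, ih]

theorem forces_disj (V : α → Set W) (w : W) (l : List (Form α)) :
    forces V w (disj l) ↔ ∃ φ ∈ l, forces V w φ := by
  induction l with
  | nil => simp [disj, forces]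
  | cons φ l ih => simp [disj, forces, ih]

theorem forces_const (v : α → Prop) (φ : Form α) (w : W) :
    forces (fun a => {_x : W | v a}) w φ ↔ classicalEval v φ := by
  induction φ generalizing w with
  | var a => exact Iff.rfl
  | bot => exact Iff.rfl
  | and φ ψ ihφ ihψ => exact and_congr (ihφ w) (ihψ w)
  | or φ ψ ihφ ihψ => exact or_congr (ihφ w) (ihψ w)
  | imp φ ψ ihφ ihψ =>
    refine ⟨fun h hφ => (ihψ w).1 (h w le_rfl ((ihφ w).2 hφ)), fun h u _ hφ => ?_⟩
    exact (ihψ u).2 (h ((ihφ u).1 hφ))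

end Semantics

end Form

/-! ### General frames and pointwise soundness -/

/-- The implication of the Heyting algebra of upper sets. -/
def kimp {W : Type*} [PartialOrder W] (A B : Set W) : Set W :=
  {w | ∀ v, w ≤ v → v ∈ A → v ∈ B}

theorem isUpperSet_kimp {W : Type*} [PartialOrder W] (A B : Set W) : IsUpperSet (kimp A B) :=
  fun _ _ h hw u hu => hw u (h.trans hu)

/-- The families of sets of a general frame: families of upper sets closed under the operations of
the Heyting algebra of upper sets. -/
structure IsAdmissible {W : Type*} [PartialOrder W] (𝒜 : Set (Set W)) : Prop where
  upper : ∀ A ∈ 𝒜, IsUpperSet A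
  empty : ∅ ∈ 𝒜
  inter : ∀ A ∈ 𝒜, ∀ B ∈ 𝒜, A ∩ B ∈ 𝒜
  union : ∀ A ∈ 𝒜, ∀ B ∈ 𝒜, A ∪ B ∈ 𝒜
  kimp : ∀ A ∈ 𝒜, ∀ B ∈ 𝒜, kimp A B ∈ 𝒜

theorem isAdmissible_isUpperSet (W : Type*) [PartialOrder W] :
    IsAdmissible {A : Set W | IsUpperSet A} where
  upper _ h := h
  empty := isUpperSet_empty
  inter _ hA _ hB := hA.inter hB
  union _ hA _ hB := hA.union hB
  kimp A _ B _ := isUpperSet_kimp A B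

namespace IsAdmissible

variable {W : Type*} [PartialOrder W] {𝒜 : Set (Set W)}

theorem truthSet (h𝒜 : IsAdmissible 𝒜) {α : Type} {V : α → Set W} (hV : ∀ a, V a ∈ 𝒜)
    (φ : Form α) : {w | forces V w φ} ∈ 𝒜 := by
  induction φ with
  | var a => exact hV a
  | bot => exact h𝒜.empty
  | and φ ψ ihφ ihψ => exact h𝒜.inter _ ihφ _ ihψ
  | or φ ψ ihφ ihψ => exact h𝒜.union _ ihφ _ ihψ
  | imp φ ψ ihφ ihψ => exact h𝒜.kimp _ ihφ _ ihψ

/-- Soundness at a point of a general frame. -/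
theorem forces_of_derivable (h𝒜 : IsAdmissible 𝒜) (w : W) {Γ : Set (Form ℕ)}
    (hΓ : ∀ φ ∈ Γ, ∀ V : ℕ → Set W, (∀ a, V a ∈ 𝒜) → forces V w φ) {φ : Form ℕ}
    (hφ : Derivable Γ φ) : ∀ V : ℕ → Set W, (∀ a, V a ∈ 𝒜) → forces V w φ := by
  induction hφ with
  | ax h => exact hΓ _ h
  | imp_k φ ψ =>
    exact fun V hV u _ hu v hv _ => forces_mono (fun a => h𝒜.upper _ (hV a)) _ hv hu
  | imp_s φ ψ χ =>
    exact fun V hV u _ h₁ v hv h₂ x hx h₃ => h₁ x (hv.trans hx) h₃ x le_rfl (h₂ x hx h₃)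
  | and_left φ ψ => exact fun V hV u _ h => h.1
  | and_right φ ψ => exact fun V hV u _ h => h.2
  | and_intro φ ψ =>
    exact fun V hV u _ hu v hv h => ⟨forces_mono (fun a => h𝒜.upper _ (hV a)) _ hv hu, h⟩
  | or_left φ ψ => exact fun V hV u _ h => Or.inl h
  | or_right φ ψ => exact fun V hV u _ h => Or.inr h
  | or_elim φ ψ χ =>
    exact fun V hV u _ h₁ v hv h₂ x hx h => h.elim (h₁ x (hv.trans hx)) (h₂ x hx)
  | bot_elim φ => exact fun V hV u _ h => h.elim
  | mp _ _ ih₁ ih₂ => exact fun V hV => ih₁ V hV w le_rfl (ih₂ V hV)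
  | subst σ _ ih =>
    exact fun V hV => (forces_subst V σ _ w).2 (ih _ fun a => h𝒜.truthSet hV (σ a))

end IsAdmissible

/-! ### Truth sets of Shehtman's formulas -/

section Columns

variable {W : Type*} [PartialOrder W]

/-- The truth sets of `β_{n-1}` (for `true`) and `γ_{n-1}` (for `false`), if `X true` and
`X false` are the truth sets of `q` and `p`. -/
def col (X : Bool → Set W) : ℕ → Bool → Set W
  | 0, t => X !t
  | 1, t => kimp (X t) (X !t)
  | n + 2, t => kimp (col X (n + 1) !t) (col X (n + 1) t ∪ col X n !t)

/-- The truth set of `α_n`. -/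
def gap (X : Bool → Set W) (n : ℕ) : Set W :=
  kimp (col X (n + 3) true ∩ col X (n + 3) false) (col X (n + 2) true ∪ col X (n + 2) false)

/-- The two upper sets assigned to `q = var 1` and `p = var 0`. -/
def valPair (V : ℕ → Set W) (t : Bool) : Set W := V (cond t 1 0)

theorem forces_betaGamma (V : ℕ → Set W) (n : ℕ) (w : W) :
    (forces V w (betaGamma n).1 ↔ w ∈ col (valPair V) n true) ∧
      (forces V w (betaGamma n).2 ↔ w ∈ col (valPair V) n false) := by
  induction n using Nat.strong_induction_on generalizing w with
  | _ n ih =>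
    match n with
    | 0 => exact ⟨Iff.rfl, Iff.rfl⟩
    | 1 => exact ⟨Iff.rfl, Iff.rfl⟩
    | n + 2 =>
      constructor <;>
      · refine forall_congr' fun v => imp_congr_right fun _ => ?_
        simp only [forces, Bool.not_true, Bool.not_false, Set.mem_union,
          ih n (by omega) v, ih (n + 1) (by omega) v]

theorem forces_shAlpha (V : ℕ → Set W) (n : ℕ) (w : W) :
    forces V w (shAlpha n) ↔ w ∈ gap (valPair V) n := by
  refine forall_congr' fun v => imp_congr_right fun _ => ?_
  simp only [forces, shBeta, shGamma, forces_betaGamma, Set.mem_union, Set.mem_inter_iff]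

theorem forces_shDelta (V : ℕ → Set W) (w : W) :
    forces V w shDelta ↔ w ∈ kimp (kimp (gap (valPair V) 0)
      (gap (valPair V) 1 ∪ gap (valPair V) 2)) (gap (valPair V) 0 ∪ gap (valPair V) 1) := by
  simp only [shDelta, shEta, shEpsilon, forces, forces_shAlpha, kimp, Set.mem_union,
    Set.mem_ofPred_eq]

theorem forces_shKappa (V : ℕ → Set W) (w : W) :
    forces V w shKappa ↔
      w ∈ kimp (gap (valPair V) 1) (gap (valPair V) 0 ∪ col (valPair V) 3 true) := by
  simp only [shKappa, shBeta, forces, forces_shAlpha, forces_betaGamma, kimp, Set.mem_union,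
    Set.mem_ofPred_eq]

theorem isUpperSet_col {X : Bool → Set W} (hX : ∀ t, IsUpperSet (X t)) :
    ∀ n t, IsUpperSet (col X n t)
  | 0, t => hX !t
  | 1, _ => isUpperSet_kimp _ _
  | _ + 2, _ => isUpperSet_kimp _ _

theorem isUpperSet_gap (X : Bool → Set W) (n : ℕ) : IsUpperSet (gap X n) := isUpperSet_kimp _ _

theorem col_subset_succ {X : Bool → Set W} (hX : ∀ t, IsUpperSet (X t)) (n : ℕ) (t : Bool) :
    col X n t ⊆ col X (n + 1) t := by
  match n with
  | 0 => exact fun w hw v hv _ => hX _ hv hw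
  | n + 1 => exact fun w hw v hv _ => Or.inl (isUpperSet_col hX _ _ hv hw)

theorem col_mono {X : Bool → Set W} (hX : ∀ t, IsUpperSet (X t)) (t : Bool) :
    Monotone fun n => col X n t :=
  monotone_nat_of_le_succ fun n => col_subset_succ hX n t

theorem exists_of_notMem_kimp {A B : Set W} {w : W} (h : w ∉ kimp A B) :
    ∃ v, w ≤ v ∧ v ∈ A ∧ v ∉ B := by
  simpa [kimp] using h

theorem exists_of_notMem_gap {X : Bool → Set W} {n : ℕ} {w : W} (h : w ∉ gap X n) :
    ∃ v, w ≤ v ∧ (∀ t, v ∈ col X (n + 3) t) ∧ ∀ t, v ∉ col X (n + 2) t := by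
  obtain ⟨v, hv, h₁, h₂⟩ := exists_of_notMem_kimp h
  exact ⟨v, hv, Bool.forall_bool.2 ⟨h₁.2, h₁.1⟩,
    Bool.forall_bool.2 ⟨fun h => h₂ (Or.inr h), fun h => h₂ (Or.inl h)⟩⟩

theorem notMem_gap {X : Bool → Set W} {n : ℕ} {w v : W} (hv : w ≤ v)
    (h₁ : ∀ t, v ∈ col X (n + 3) t) (h₂ : ∀ t, v ∉ col X (n + 2) t) : w ∉ gap X n :=
  fun h => (h v hv ⟨h₁ _, h₁ _⟩).elim (h₂ _) (h₂ _)

theorem col_swap (X : Bool → Set W) (n : ℕ) (t : Bool) :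
    col (fun u => X !u) n t = col X n !t := by
  induction n using Nat.strong_induction_on generalizing t with
  | _ n ih =>
    match n with
    | 0 => rfl
    | 1 => rfl
    | n + 2 => simp only [col, ih n (by omega), ih (n + 1) (by omega)]

/-- κ mentions only β_2; this symmetry yields its mirror image with γ_2. -/
theorem gap_swap (X : Bool → Set W) (n : ℕ) : gap (fun u => X !u) n = gap X n := by
  simp only [gap, col_swap, Bool.not_true, Bool.not_false]
  rw [Set.inter_comm, Set.union_comm]

end Columns

/-! ### Kripke frames of the axioms validate ε -/

section Completeness

variable {W : Type*} [PartialOrder W]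

/-- The substitution of `β_0 ∨ q` for `p` and of `γ_0 ∨ p` for `q`. -/
def shift (X : Bool → Set W) (t : Bool) : Set W := col X 1 (!t) ∪ X !t

theorem isUpperSet_shift {X : Bool → Set W} (hX : ∀ t, IsUpperSet (X t)) (t : Bool) :
    IsUpperSet (shift X t) :=
  (isUpperSet_col hX 1 _).union (hX _)

theorem kimp_congr_on {A A' B B' : Set W} (h : ∀ w, (w ∈ A → w ∈ B) ↔ (w ∈ A' → w ∈ B')) :
    kimp A B = kimp A' B' :=
  Set.ext fun _ => forall_congr' fun v => imp_congr_right fun _ => h v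

/-- The disjunct `X t` in `shift` supplies the earlier stage that the consequent of `col X 2 t`
contains; in antecedents it is absorbed, since `X t ⊆ col X 1 (!t)`. -/
theorem col_shift {X : Bool → Set W} (hX : ∀ t, IsUpperSet (X t)) (n : ℕ) (t : Bool) :
    col (shift X) (n + 1) t = col X (n + 2) t := by
  induction n using Nat.strong_induction_on generalizing t with
  | _ n ih =>
    have h₀ : ∀ t w, w ∈ X t → w ∈ col X 1 !t := fun t w hw v hv _ => by
      simpa using hX _ hv hw
    match n with
    | 0 =>
      refine kimp_congr_on fun w => ?_
      have h₁ := h₀ t w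
      have h₂ := h₀ (!t) w
      simp only [shift, Set.mem_union, Bool.not_not, col] at h₁ h₂ ⊢
      tauto
    | 1 =>
      have h₁ : ∀ w, w ∈ X t → w ∈ col X 2 !t := fun w hw => col_subset_succ hX _ _ (h₀ _ _ hw)
      have h₂ : ∀ w, w ∈ X (!t) → w ∈ col X 2 t := fun w hw =>
        col_subset_succ hX _ _ (by simpa using h₀ _ _ hw)
      show kimp (col (shift X) 1 !t) (col (shift X) 1 t ∪ col (shift X) 0 !t) =
        kimp (col X 2 !t) (col X 2 t ∪ col X 1 !t)
      rw [ih 0 (by omega), ih 0 (by omega)]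
      refine kimp_congr_on fun w => ?_
      have h₁ := h₁ w
      have h₂ := h₂ w
      simp only [shift, Set.mem_union, Bool.not_not, col] at h₁ h₂ ⊢
      tauto
    | n + 2 =>
      show kimp (col (shift X) (n + 2) !t) (col (shift X) (n + 2) t ∪ col (shift X) (n + 1) !t) = _
      rw [ih n (by omega), ih (n + 1) (by omega), ih (n + 1) (by omega)]
      rfl

theorem gap_shift {X : Bool → Set W} (hX : ∀ t, IsUpperSet (X t)) (n : ℕ) :
    gap (shift X) n = gap X (n + 1) := by
  simp only [gap, col_shift hX]

/-- This lets δ and κ, which speak of small indices only, be applied at every index. -/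
theorem iterate_shift {X : Bool → Set W} (hX : ∀ t, IsUpperSet (X t)) (n : ℕ) :
    (∀ t, IsUpperSet (shift^[n] X t)) ∧ (∀ k t, col (shift^[n] X) (k + 1) t = col X (n + k + 1) t) ∧
      ∀ k, gap (shift^[n] X) k = gap X (n + k) := by
  induction n with
  | zero => simp [hX]
  | succ n ih =>
    rw [Function.iterate_succ_apply']
    refine ⟨isUpperSet_shift ih.1, fun k t => ?_, fun k => ?_⟩
    · rw [col_shift ih.1, ih.2.1 (k + 1)]
      congr 1
      omega
    · rw [gap_shift ih.1, ih.2.2]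
      congr 1
      omega

theorem forces_bb_two (V : ℕ → Set W) (w : W) :
    forces V w (bb 2) ↔ ∀ v, w ≤ v → (∀ i < 3, ∀ u, v ≤ u →
      (∀ x, u ≤ x → x ∈ V i → ∃ j < 3, j ≠ i ∧ x ∈ V j) → ∃ j < 3, j ≠ i ∧ u ∈ V j) →
        ∃ i < 3, v ∈ V i := by
  simp [bb, forces, forces_conj, forces_disj, and_assoc]

theorem exists_valuation (X : Bool → Set W) (hX : ∀ t, IsUpperSet (X t)) :
    ∃ V : ℕ → Set W, (∀ a, IsUpperSet (V a)) ∧ valPair V = X := by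
  refine ⟨fun a => X (decide (a = 1)), fun a => hX _, funext fun t => ?_⟩
  cases t <;> rfl

/-- `{n | u ∉ gap X n}` is empty, a singleton or a final segment of `ℕ`, if `δ` and `κ` are
valid. -/
theorem gap_trichotomy (hδ : ValidIn W shDelta) (hκ : ValidIn W shKappa) {X : Bool → Set W}
    (hX : ∀ t, IsUpperSet (X t)) {u : W} {n : ℕ} (hn : u ∉ gap X n) (hn' : u ∈ gap X (n + 1)) :
    ∀ m, m ≠ n → u ∈ gap X m := by
  -- κ shifted by n, together with its mirror image: where α_n fails and α_{n+1} holds, both β_{n+2}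
  -- and γ_{n+2} hold.
  have key : ∀ n (u : W), u ∉ gap X n → u ∈ gap X (n + 1) → ∀ t, u ∈ col X (n + 3) t := by
    intro n u hn hn'
    have hval : ∀ Y : Bool → Set W, (∀ t, IsUpperSet (Y t)) → u ∉ gap Y 0 → u ∈ gap Y 1 →
        u ∈ col Y 3 true := fun Y hY h₀ h₁ => by
      obtain ⟨V, hV, rfl⟩ := exists_valuation Y hY
      exact (((forces_shKappa V u).1 (hκ V hV u)) u le_rfl h₁).resolve_left h₀
    obtain ⟨hY, hc, hg⟩ := iterate_shift hX n
    refine Bool.forall_bool.2 ⟨?_, ?_⟩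
    · have := hval (fun t => shift^[n] X !t) (fun t => hY _)
      rw [gap_swap, gap_swap, col_swap, hg, hg, hc] at this
      exact this hn hn'
    · have := hval _ hY
      rw [hg, hg, hc] at this
      exact this hn hn'
  have hu := key n u hn hn'
  have hup : ∀ m, n + 1 ≤ m → u ∈ gap X m := fun m hm v hv _ =>
    Or.inl (col_mono hX _ (by omega : n + 3 ≤ m + 2) (isUpperSet_col hX _ _ hv (hu _)))
  -- If α_k held and α_{k-1} failed, `key` would put `u` into columns of index k + 2 ≤ n + 2, which
  -- the refutation of α_n forbids.
  have hdown : ∀ k, k + 1 ≤ n → u ∈ gap X k → k = 0 ∨ u ∈ gap X (k - 1) := by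
    intro k hk h
    by_contra! hc
    have := key (k - 1) u hc.2 (by rwa [Nat.sub_add_cancel (by omega)])
    obtain ⟨v, hv, -, h₂⟩ := exists_of_notMem_gap hn
    exact h₂ true (col_mono hX _ (by omega : k - 1 + 3 ≤ n + 2)
      (isUpperSet_col hX _ _ hv (this _)))
  -- δ shifted by n - 1; its premise holds because of the last disjunct α_{n+1}.
  have hpred : n = 0 ∨ u ∈ gap X (n - 1) := by
    refine or_iff_not_imp_left.2 fun h0 => ?_
    obtain ⟨k, rfl⟩ := Nat.exists_eq_succ_of_ne_zero h0
    obtain ⟨hY, -, hg⟩ := iterate_shift hX k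
    obtain ⟨V, hV, hVY⟩ := exists_valuation _ hY
    have := (forces_shDelta V u).1 (hδ V hV u) u le_rfl
    rw [hVY, hg, hg, hg] at this
    refine (this fun v hv _ => Or.inr ?_).resolve_right hn
    exact isUpperSet_gap _ _ hv hn'
  have hlow : ∀ j, j < n → u ∈ gap X (n - 1 - j) := by
    intro j hj
    induction j with
    | zero => exact hpred.resolve_left (by omega)
    | succ j ih =>
      have := (hdown (n - 1 - j) (by omega) (ih (by omega))).resolve_left (by omega)
      rwa [Nat.sub_sub] at this
  intro m hm
  rcases lt_or_gt_of_ne hm with h | h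
  · have := hlow (n - 1 - m) (by omega)
    rwa [show n - 1 - (n - 1 - m) = m by omega] at this
  · exact hup m h

/-- Every Kripke frame for `δ`, `κ` and `bb₂` validates `ε`. -/
theorem validIn_shEpsilon (hδ : ValidIn W shDelta) (hκ : ValidIn W shKappa)
    (hbb : ValidIn W (bb 2)) : ValidIn W shEpsilon := by
  intro V hV w
  by_contra hw
  set X := valPair V with hXdef
  have hX : ∀ t, IsUpperSet (X t) := fun t => hV _
  have h01 : w ∉ gap X 0 ∧ w ∉ gap X 1 := by
    simpa [shEpsilon, forces, forces_shAlpha] using hw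
  have htri : ∀ {u : W} {n : ℕ}, u ∉ gap X n → u ∈ gap X (n + 1) → ∀ m, m ≠ n → u ∈ gap X m :=
    gap_trichotomy hδ hκ hX
  have hall : ∀ {u : W} {n : ℕ}, u ∉ gap X n → u ∉ gap X (n + 1) → ∀ m, n ≤ m → u ∉ gap X m := by
    intro u n hn hn' m hm
    induction m, hm using Nat.le_induction with
    | base => exact hn
    | succ m hm ih =>
      rcases hm.eq_or_lt with rfl | hlt
      · exact hn'
      · exact fun h => hn (htri ih h n (by omega))
  -- The point where the implication α_n breaks lies in both columns of index n + 3, which makes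
  -- α_{n+1} true there.
  have htooth : ∀ {u : W} {n : ℕ}, u ∉ gap X n → ∃ v, u ≤ v ∧ v ∉ gap X n ∧ v ∈ gap X (n + 1) := by
    intro u n hn
    obtain ⟨v, hv, h₁, h₂⟩ := exists_of_notMem_gap hn
    exact ⟨v, hv, notMem_gap le_rfl h₁ h₂,
      fun x hx _ => Or.inl (isUpperSet_col hX _ _ hx (h₁ true))⟩
  -- `Y i` holds the points that refute at most one α_n, and that only for n ≡ i mod 3. Points
  -- refuting none lie in every `Y i`; `w` lies in none.
  let Y : ℕ → Set W := fun i => {u | (∀ n, u ∉ gap X n → u ∈ gap X (n + 1)) ∧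
    ∀ n, u ∉ gap X n → n % 3 = i}
  have hYup : ∀ i, IsUpperSet (Y i) := by
    intro i u v huv hu
    refine ⟨fun n hn => ?_, fun n hn => hu.2 n fun h => hn (isUpperSet_gap _ _ huv h)⟩
    exact isUpperSet_gap _ _ huv (hu.1 n fun h => hn (isUpperSet_gap _ _ huv h))
  have hY : ∀ i < 3, ∀ u, w ≤ u →
      (∀ x, u ≤ x → x ∈ Y i → ∃ j < 3, j ≠ i ∧ x ∈ Y j) → ∃ j < 3, j ≠ i ∧ u ∈ Y j := by
    intro i hi u _ hu
    by_contra! hc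
    have hvis : ∃ n, n % 3 = i ∧ u ∉ gap X n := by
      by_cases hs : ∀ n, u ∉ gap X n → u ∈ gap X (n + 1)
      · have hne : ∃ n, u ∉ gap X n := by
          by_contra! h
          exact hc ((i + 1) % 3) (Nat.mod_lt _ (by omega)) (by omega)
            ⟨fun n hn => (hn (h n)).elim, fun n hn => (hn (h n)).elim⟩
        obtain ⟨n, hn⟩ := hne
        refine ⟨n, ?_, hn⟩
        by_contra hni
        refine hc (n % 3) (Nat.mod_lt _ (by omega)) hni ⟨hs, fun m hm => ?_⟩
        by_contra hmn
        exact hm (htri hn (hs n hn) m (by rintro rfl; exact hmn rfl))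
      · push Not at hs
        obtain ⟨n, hn, hn'⟩ := hs
        -- Everything from n on is refuted, and 3n + i is an index at least n in the required class.
        exact ⟨3 * n + i, by omega, hall hn hn' _ (by omega)⟩
    obtain ⟨n, hni, hn⟩ := hvis
    obtain ⟨v, hv, h₁, h₂⟩ := htooth hn
    have h₃ := htri h₁ h₂
    have hval : ∀ m, v ∉ gap X m → m = n := fun m hm => by
      by_contra h
      exact hm (h₃ m h)
    obtain ⟨j, -, hji, hj⟩ := hu v hv
      ⟨fun m hm => by rw [hval m hm]; exact h₂, fun m hm => by rw [hval m hm]; exact hni⟩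
    exact hji ((hj.2 n h₁).symm.trans hni)
  obtain ⟨i, -, hi⟩ := (forces_bb_two Y w).1 (hbb Y hYup w) w le_rfl hY
  exact h01.2 (hi.1 0 h01.1)

end Completeness

/-! ### The comb and the valuations on it that refute some α_k -/

/-- An infinite comb on top of which sits an infinite ladder: `tooth n` sees the levels up to
`n + 1` of the ladder, the points `spine n` form an ascending chain, `spine n` sees `tooth m` for
`n ≤ m`, and `foot n` is an additional point immediately below `tooth n`. -/
inductive Comb : Type
  | lad : Bool → ℕ → Comb
  | tooth : ℕ → Comb
  | foot : ℕ → Comb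
  | spine : ℕ → Comb

namespace Comb

/-- The order of the comb. -/
def Le : Comb → Comb → Prop
  | lad t i, lad u j => (t = u ∧ j ≤ i) ∨ j + 2 ≤ i
  | tooth n, lad _ j => j ≤ n + 1
  | foot n, lad _ j => j ≤ n + 1
  | spine _, lad _ _ => True
  | tooth n, tooth m => n = m
  | foot n, tooth m => n = m
  | spine n, tooth m => n ≤ m
  | foot n, foot m => n = m
  | spine n, spine m => n ≤ m
  | _, _ => False

instance : PartialOrder Comb where
  le := Le
  le_refl a := by cases a <;> simp [Le]
  le_trans a b c h k := by
    rcases a with ⟨t, i⟩ | i | i | i <;> rcases b with ⟨u, j⟩ | j | j | j <;>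
      rcases c with ⟨v, k⟩ | k | k | k <;> simp only [Le] at * <;> grind
  le_antisymm a b h k := by
    rcases a with ⟨t, i⟩ | i | i | i <;> rcases b with ⟨u, j⟩ | j | j | j <;>
      simp only [Le] at * <;> grind

section Order

variable (t u : Bool) (i j : ℕ)

@[simp] theorem lad_le_lad : lad t i ≤ lad u j ↔ (t = u ∧ j ≤ i) ∨ j + 2 ≤ i := Iff.rfl
@[simp] theorem tooth_le_lad : tooth i ≤ lad u j ↔ j ≤ i + 1 := Iff.rfl
@[simp] theorem foot_le_lad : foot i ≤ lad u j ↔ j ≤ i + 1 := Iff.rfl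
@[simp] theorem spine_le_lad : spine i ≤ lad u j ↔ True := Iff.rfl
@[simp] theorem tooth_le_tooth : tooth i ≤ tooth j ↔ i = j := Iff.rfl
@[simp] theorem foot_le_tooth : foot i ≤ tooth j ↔ i = j := Iff.rfl
@[simp] theorem spine_le_tooth : spine i ≤ tooth j ↔ i ≤ j := Iff.rfl
@[simp] theorem foot_le_foot : foot i ≤ foot j ↔ i = j := Iff.rfl
@[simp] theorem spine_le_spine : spine i ≤ spine j ↔ i ≤ j := Iff.rfl
@[simp] theorem lad_le_tooth : lad t i ≤ tooth j ↔ False := Iff.rfl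
@[simp] theorem lad_le_foot : lad t i ≤ foot j ↔ False := Iff.rfl
@[simp] theorem lad_le_spine : lad t i ≤ spine j ↔ False := Iff.rfl
@[simp] theorem tooth_le_foot : tooth i ≤ foot j ↔ False := Iff.rfl
@[simp] theorem tooth_le_spine : tooth i ≤ spine j ↔ False := Iff.rfl
@[simp] theorem foot_le_spine : foot i ≤ spine j ↔ False := Iff.rfl
@[simp] theorem spine_le_foot : spine i ≤ foot j ↔ False := Iff.rfl

end Order

theorem eq_foot_of_le {x : Comb} {n : ℕ} (h : x ≤ foot n) : x = foot n := by
  rcases x with ⟨u, j⟩ | j | j | j <;> simp_all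

/-- The restriction to the ladder of the values of `p` and `q` in a model that refutes some
`α_k`. -/
structure Pattern (X : Bool → Set Comb) (s : ℕ) : Prop where
  upper : ∀ t, IsUpperSet (X t)
  mem : ∀ t, lad t s ∈ X t
  notMem : ∀ t, lad t s ∉ X !t
  notMem_succ : ∀ t, lad t (s + 1) ∉ X t
  below : ∀ t u, ∀ i < s, lad t i ∈ X u

/-- Only a foot lies below itself, so the common lower bound `x` keeps `y₀` and `y₁` from being
feet. Among the remaining points this configuration occurs only at adjacent levels of the two
columns. -/
theorem ladder_position {x y₀ y₁ z₀ z₁ : Comb} (hx₀ : x ≤ y₀) (hx₁ : x ≤ y₁) (h₀ : y₀ ≤ z₀)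
    (h₁ : y₁ ≤ z₁) (hne₀ : z₀ ≠ y₀) (hne₁ : z₁ ≠ y₁) (h₀₁ : ¬ y₀ ≤ z₁) (h₁₀ : ¬ y₁ ≤ z₀) :
    ∃ t s, y₀ = lad t (s + 1) ∧ z₀ = lad t s ∧ y₁ = lad (!t) (s + 1) ∧ z₁ = lad (!t) s := by
  have hf₀ : ∀ n, y₀ ≠ foot n := by
    rintro n rfl
    rw [eq_foot_of_le hx₀] at hx₁
    exact h₀₁ (hx₁.trans h₁)
  have hf₁ : ∀ n, y₁ ≠ foot n := by
    rintro n rfl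
    rw [eq_foot_of_le hx₁] at hx₀
    exact h₁₀ (hx₀.trans h₀)
  clear hx₀ hx₁ x
  have hlad : ∃ t i u j, y₀ = lad t i ∧ y₁ = lad u j := by
    rcases y₀ with ⟨t, i⟩ | i | i | i <;> rcases y₁ with ⟨u, j⟩ | j | j | j <;>
      rcases z₀ with ⟨v, k⟩ | k | k | k <;> simp only [lad_le_lad, tooth_le_lad, foot_le_lad,
        spine_le_lad, tooth_le_tooth, foot_le_tooth, spine_le_tooth, foot_le_foot,
        spine_le_spine, lad_le_tooth, lad_le_foot, lad_le_spine, tooth_le_foot, tooth_le_spine,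
        foot_le_spine, spine_le_foot, not_true_eq_false] at * <;> rcases z₁ with ⟨w, l⟩ | l | l | l <;>
      simp only [lad_le_lad, tooth_le_lad, foot_le_lad,
        spine_le_lad, tooth_le_tooth, foot_le_tooth, spine_le_tooth, foot_le_foot,
        spine_le_spine, lad_le_tooth, lad_le_foot, lad_le_spine, tooth_le_foot, tooth_le_spine,
        foot_le_spine, spine_le_foot, not_true_eq_false] at * <;> grind
  obtain ⟨t, i, u, j, rfl, rfl⟩ := hlad
  rcases z₀ with ⟨v, k⟩ | k | k | k <;> rcases z₁ with ⟨w, l⟩ | l | l | l <;>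
    simp only [lad_le_lad, lad_le_tooth, lad_le_foot, lad_le_spine] at h₀ h₁ h₀₁ h₁₀
  simp only [ne_eq, lad.injEq, not_and] at hne₀ hne₁
  have hij : i = k + 1 ∧ j = k + 1 ∧ l = k := by grind
  obtain ⟨rfl, rfl, rfl⟩ := hij
  have hvt : v = t ∧ w = u ∧ t ≠ u := by grind
  obtain ⟨rfl, rfl, hne⟩ := hvt
  refine ⟨v, l, rfl, rfl, ?_⟩
  cases v <;> cases w <;> simp_all

/-- Refuting α_k refutes β_1 and γ_1. Unfolding these twice gives `y t`, where `X !t` implies `X t`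
but `X t` fails, and above it `z t` in `X t` but not in `X !t`. `ladder_position` locates these four
points. -/
theorem exists_pattern {X : Bool → Set Comb} (hX : ∀ t, IsUpperSet (X t)) {x : Comb} {k : ℕ}
    (hx : x ∉ gap X k) : ∃ s, Pattern X s ∨ Pattern (fun t => X !t) s := by
  have hyz : ∀ t, ∃ y z, x ≤ y ∧ y ≤ z ∧ y ∈ col X 1 (!t) ∧ y ∉ X t ∧ z ∈ X t ∧ z ∉ X !t := by
    intro t
    obtain ⟨v, hv, -, h⟩ := exists_of_notMem_gap hx
    have h₂ : v ∉ col X 2 t := fun h' => h t (col_mono hX _ (by omega : 2 ≤ k + 2) h')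
    obtain ⟨y, hy, h₃, h₄⟩ := exists_of_notMem_kimp h₂
    have h₅ : y ∉ col X 1 t ∧ y ∉ col X 0 !t := by simpa using h₄
    obtain ⟨z, hz, h₆, h₇⟩ := exists_of_notMem_kimp h₅.1
    exact ⟨y, z, hv.trans hy, hz, h₃, by simpa [col] using h₅.2, h₆, h₇⟩
  choose y z hxy hyz hcol hyX hzX hzX' using hyz
  have himp : ∀ t w, y t ≤ w → w ∈ X (!t) → w ∈ X t := fun t w hw h => by
    simpa using hcol t w hw h
  have hne : ∀ t, z t ≠ y t := fun t h => hyX t (h ▸ hzX t)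
  have hnle : ∀ t, ¬ y t ≤ z !t := fun t h => by
    have := hzX' (!t)
    rw [Bool.not_not] at this
    exact this (himp t _ h (hzX _))
  obtain ⟨t, s, h₀, h₁, h₂, h₃⟩ := ladder_position (hxy true) (hxy false) (hyz true) (hyz false)
    (hne true) (hne false) (hnle true) (hnle false)
  have main : ∀ Y : Bool → Set Comb, (∀ t, IsUpperSet (Y t)) → (∀ t, lad t s ∈ Y t) →
      (∀ t, lad t s ∉ Y !t) → (∀ t, lad t (s + 1) ∉ Y t) →
      (∀ t w, lad t (s + 1) ≤ w → w ∈ Y (!t) → w ∈ Y t) → Pattern Y s := by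
    intro Y hY hm hn hs hi
    refine ⟨hY, hm, hn, hs, fun t u i hi' => ?_⟩
    have hmem : ∀ u, lad u i ∈ Y u := fun u => hY u (by simp; omega) (hm u)
    rcases Bool.eq_or_eq_not u t with rfl | rfl
    · exact hmem u
    · exact hi _ _ (by simp; omega) (by simpa using hmem t)
  have hzX₀ := hzX' true
  have hzX₁ := hzX' false
  have hm₀ := hzX true
  have hm₁ := hzX false
  have hy₀ := hyX true
  have hy₁ := hyX false
  have hi₀ := himp true
  have hi₁ := himp false
  rw [h₀] at hy₀ hi₀
  rw [h₁] at hzX₀ hm₀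
  rw [h₂] at hy₁ hi₁
  rw [h₃] at hzX₁ hm₁
  refine ⟨s, ?_⟩
  cases t
  · refine Or.inr (main _ (fun t => hX _) ?_ ?_ ?_ ?_) <;> rw [Bool.forall_bool] <;>
      constructor <;> assumption
  · refine Or.inl (main _ hX ?_ ?_ ?_ ?_) <;> rw [Bool.forall_bool] <;>
      constructor <;> assumption

/-- The points of the comb that are not feet or see the ladder at level `s`. -/
def Good (s : ℕ) (x : Comb) : Prop := ∀ n, x = foot n → s ≤ n + 1

theorem Good.mono {s : ℕ} {x y : Comb} (hx : Good s x) (h : x ≤ y) : Good s y := by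
  rintro n rfl
  exact hx n (eq_foot_of_le h)

theorem eq_or_eq_of_le {y : Comb} {t : Bool} {s : ℕ} (h₁ : y ≤ lad t s) (h₂ : ¬ y ≤ lad (!t) s) :
    y = lad t s ∨ y = lad t (s + 1) := by
  rcases y with ⟨u, j⟩ | j | j | j
  · simp only [lad_le_lad, lad.injEq] at *
    grind
  all_goals simp only [tooth_le_lad, foot_le_lad, spine_le_lad] at h₁ h₂; exact (h₂ h₁).elim

theorem eq_lad_of_le {y : Comb} {t : Bool} {m : ℕ} (h₁ : y ≤ lad t (m + 1)) (h₂ : y ≤ lad (!t) m)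
    (h₃ : ¬ y ≤ lad (!t) (m + 1)) : y = lad t (m + 2) := by
  rcases y with ⟨u, j⟩ | j | j | j
  · simp only [lad_le_lad, lad.injEq] at *
    cases t <;> cases u <;> simp_all <;> omega
  all_goals simp only [tooth_le_lad, foot_le_lad, spine_le_lad] at h₁ h₃; exact (h₃ h₁).elim

theorem le_tooth_of_le {y : Comb} {m : ℕ} (h₁ : ∀ t, y ≤ lad t (m + 1))
    (h₂ : ∀ t, ¬ y ≤ lad t (m + 2)) : y ≤ tooth m := by
  have h₁t := h₁ true
  have h₁f := h₁ false
  have h₂t := h₂ true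
  have h₂f := h₂ false
  rcases y with ⟨u, j⟩ | j | j | j <;> simp at * <;> grind

namespace Pattern

variable {X : Bool → Set Comb} {s : ℕ}

theorem notMem_col_one_iff (hP : Pattern X s) {x : Comb} (hx : ∃ u, x ≤ lad u s) (t : Bool) :
    x ∉ col X 1 t ↔ x ≤ lad t s := by
  refine ⟨fun h => ?_, fun h h' => hP.notMem t (h' _ h (hP.mem t))⟩
  by_contra hxt
  obtain ⟨z, hz, h₁, h₂⟩ := exists_of_notMem_kimp h
  obtain ⟨u, hu⟩ := hx
  obtain rfl : u = !t := by
    rcases Bool.eq_or_eq_not u t with rfl | rfl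
    · exact (hxt hu).elim
    · rfl
  have hlad : ∃ v j, z = lad v j ∧ lad (!t) (s + 1) ≤ z := by
    have : lad (!t) (s + 1) ≤ x := by
      rcases eq_or_eq_of_le hu (by simpa using hxt) with rfl | rfl <;> simp
    have hz' := this.trans hz
    rcases z with ⟨v, j⟩ | j | j | j
    · exact ⟨v, j, rfl, hz'⟩
    all_goals simp at hz'
  obtain ⟨v, j, rfl, hle⟩ := hlad
  by_cases hj : j < s
  · exact h₂ (hP.below _ _ _ hj)
  · have hv : lad v j ≤ lad (!t) s := by
      simp only [lad_le_lad] at hle ⊢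
      grind
    have := hP.notMem (!t)
    rw [Bool.not_not] at this
    exact this (hP.upper t hv h₁)

/-- Ladder points above `x` lie in both sets. What remains of the cone is at most a tooth and its
foot, a chain, on which upper sets are comparable. -/
theorem mem_col_one_or (hP : Pattern X s) {x : Comb} (hx : ¬ ∃ u, x ≤ lad u s) :
    ∃ t, x ∈ col X 1 t := by
  by_contra! h
  push Not at hx
  obtain ⟨z, hz, h₁, h₂⟩ := exists_of_notMem_kimp (h true)
  obtain ⟨z', hz', h₁', h₂'⟩ := exists_of_notMem_kimp (h false)
  have hnl : ∀ z, x ≤ z → (∃ t, z ∉ X t) → ∀ v j, z ≠ lad v j := by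
    rintro z hz ⟨t, ht⟩ v j rfl
    by_cases hj : j < s
    · exact ht (hP.below _ _ _ hj)
    · exact hx v (hz.trans (by simp; omega))
  have hcmp : z ≤ z' ∨ z' ≤ z := by
    have hl := hnl z hz ⟨_, h₂⟩
    have hl' := hnl z' hz' ⟨_, h₂'⟩
    have hx' := hx true
    rcases x with ⟨u, i⟩ | i | i | i <;> rcases z with ⟨v, j⟩ | j | j | j <;>
      rcases z' with ⟨w, k⟩ | k | k | k <;> simp_all
  rcases hcmp with h | h
  · exact h₂' (hP.upper _ h h₁)
  · exact h₂ (hP.upper _ h h₁')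

/-- `Good` is needed: a foot not reaching level s may leave `col X 2 t` because of the tooth just
above it. -/
theorem notMem_col_two_iff (hP : Pattern X s) {x : Comb} (hx : Good s x) (t : Bool) :
    x ∉ col X 2 t ↔ x ≤ lad t (s + 1) := by
  constructor
  · intro h
    obtain ⟨y, hy, h₁, h₂⟩ := exists_of_notMem_kimp h
    simp only [Set.mem_union, not_or, col, Bool.not_not] at h₂
    obtain ⟨z, hz, h₃, h₄⟩ := exists_of_notMem_kimp h₂.1
    by_cases hys : ∃ u, y ≤ lad u s
    · have h₅ := (hP.notMem_col_one_iff hys t).1 h₂.1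
      have h₆ : ¬ y ≤ lad (!t) s := fun h => (hP.notMem_col_one_iff hys _).2 h h₁
      rcases eq_or_eq_of_le h₅ h₆ with rfl | rfl
      · exact (h₂.2 (hP.mem t)).elim
      · exact hy
    · exfalso
      push Not at hys
      have hyg := hx.mono hy
      rcases y with ⟨u, i⟩ | i | i | i
      · refine h₂.2 (hP.below _ _ _ ?_)
        have := hys u
        simp at this
        omega
      · rcases z with ⟨v, j⟩ | j | j | j
        · have := hys true
          simp at hz this
          exact h₄ (hP.below _ _ _ (by omega))
        · obtain rfl : i = j := by simpa using hz
          exact h₂.2 h₃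
        all_goals simp at hz
      · have := hys true
        have := hyg i rfl
        simp_all
      · simpa using hys true
  · intro h h'
    have hle : ∃ u, lad t (s + 1) ≤ lad u s := ⟨t, by simp⟩
    refine (h' _ h ?_).elim ((hP.notMem_col_one_iff hle _).2 (by simp)) ?_
    · by_contra hc
      have := (hP.notMem_col_one_iff hle _).1 hc
      simp at this
    · simpa [col] using hP.notMem_succ t

/-- In the inductive step the implication breaks at a single point: only `lad t (s + n + 2)` is
below `lad t (s + n + 1)` and `lad (!t) (s + n)` but not below `lad (!t) (s + n + 1)`. -/
theorem notMem_col_iff (hP : Pattern X s) {x : Comb} (hx : Good s x) (n : ℕ) (t : Bool) :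
    x ∉ col X (n + 2) t ↔ x ≤ lad t (s + n + 1) := by
  induction n using Nat.strong_induction_on generalizing t x with
  | _ n ih =>
    match n with
    | 0 => exact hP.notMem_col_two_iff hx t
    | n + 1 =>
      have hsucc : ∀ {y : Comb}, Good s y → ∀ t, y ∉ col X (n + 2) t ↔ y ≤ lad t (s + n + 1) :=
        fun hy t => ih n (by omega) hy t
      have hpred : ∀ {y : Comb}, Good s y → y ≤ lad t (s + n + 1) →
          ∀ t, y ∉ col X (n + 1) t ↔ y ≤ lad t (s + n) := by
        intro y hy hle u
        match n with
        | 0 => exact hP.notMem_col_one_iff ⟨t, hle.trans (by simp)⟩ u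
        | n + 1 => exact ih n (by omega) hy u
      constructor
      · intro h
        obtain ⟨y, hy, h₁, h₂⟩ := exists_of_notMem_kimp h
        simp only [Set.mem_union, not_or] at h₂
        have hyg := hx.mono hy
        have h₃ := (hsucc hyg t).1 h₂.1
        have h₄ : ¬ y ≤ lad (!t) (s + n + 1) := fun h => (hsucc hyg _).2 h h₁
        have h₅ := (hpred hyg h₃ _).1 h₂.2
        rw [eq_lad_of_le h₃ h₅ h₄] at hy
        exact hy
      · intro h h'
        have hg : Good s (lad t (s + (n + 1) + 1)) := hx.mono h
        have hle : lad t (s + (n + 1) + 1) ≤ lad t (s + n + 1) := by simp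
        refine (h' _ h ?_).elim ((hsucc hg _).2 hle) ((hpred hg hle _).2 (by simp))
        by_contra hc
        have := (hsucc hg _).1 hc
        simp at this
        omega

/-- Feet that are not `Good` do no harm: by `mem_col_one_or` they lie in one of the columns from
index 1 on. -/
theorem notMem_gap_iff (hP : Pattern X s) {x : Comb} (k : ℕ) :
    x ∉ gap X k ↔ x ≤ tooth (s + k) := by
  constructor
  · intro h
    obtain ⟨y, hy, h₁, h₂⟩ := exists_of_notMem_gap h
    by_cases hyg : Good s y
    · refine hy.trans (le_tooth_of_le (fun t => (hP.notMem_col_iff hyg k t).1 (h₂ t)) fun t h => ?_)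
      exact (hP.notMem_col_iff hyg (k + 1) t).2 h (h₁ t)
    · simp only [Good, not_forall] at hyg
      obtain ⟨n, rfl, hn⟩ := hyg
      obtain ⟨t, ht⟩ := hP.mem_col_one_or (x := foot n) (by simp; omega)
      exact (h₂ t (col_mono hP.upper t (by omega : 1 ≤ k + 2) ht)).elim
  · intro h
    have hg : Good s (tooth (s + k)) := fun n h => by cases h
    refine notMem_gap h (fun t => ?_) fun t => (hP.notMem_col_iff hg k t).2 (by simp)
    by_contra hc
    have := (hP.notMem_col_iff hg (k + 1) t).1 hc
    simp at this

end Pattern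

/-- A point refuting α_0 and α_1 is below `tooth s` and `tooth (s + 1)`, hence on the spine and
below `spine (s + 1)`, which refutes α_1 and α_2 but not α_0. -/
theorem forces_shDelta_comb {V : ℕ → Set Comb} (hV : ∀ a, IsUpperSet (V a)) (x : Comb) :
    forces V x shDelta := by
  rw [forces_shDelta]
  intro y _ hy
  by_contra hc
  simp only [Set.mem_union, not_or] at hc
  obtain ⟨s, hs⟩ := exists_pattern (X := valPair V) (fun t => hV _) hc.1
  have hgap : ∀ x k, x ∉ gap (valPair V) k ↔ x ≤ tooth (s + k) := by
    intro x k
    rcases hs with hs | hs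
    · exact hs.notMem_gap_iff k
    · rw [← hs.notMem_gap_iff k, gap_swap]
  have h₀ := (hgap y 0).1 hc.1
  have h₁ := (hgap y 1).1 hc.2
  have hle : y ≤ spine (s + 1) := by
    rcases y with ⟨u, j⟩ | j | j | j <;> simp at h₀ h₁ ⊢ <;> omega
  rcases hy (spine (s + 1)) hle (by by_contra h; simpa using (hgap _ _).1 h) with h | h
  · exact (hgap _ _).2 (by simp) h
  · exact (hgap _ _).2 (by simp) h

/-- Only `tooth s` and `foot s` refute α_0 without refuting α_1, and they do not see level s + 2. -/
theorem forces_shKappa_comb {V : ℕ → Set Comb} (hV : ∀ a, IsUpperSet (V a)) (x : Comb) :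
    forces V x shKappa := by
  rw [forces_shKappa]
  intro y _ hy
  by_contra hc
  simp only [Set.mem_union, not_or] at hc
  obtain ⟨s, hs⟩ := exists_pattern (X := valPair V) (fun t => hV _) hc.1
  have main : ∀ X t, Pattern X s → y ∈ gap X 1 → y ∉ gap X 0 → y ∉ col X 3 t → False := by
    intro X t hP h₁ h₀ h
    have h₀ := (hP.notMem_gap_iff 0).1 h₀
    have h₁ : ¬ y ≤ tooth (s + 1) := fun h => (hP.notMem_gap_iff 1).2 h h₁
    have hyg : Good s y := by
      rintro n rfl
      simp at h₀
      omega
    have h₂ := (hP.notMem_col_iff hyg 1 t).1 h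
    rcases y with ⟨u, j⟩ | j | j | j <;> simp at h₀ h₁ h₂ <;> omega
  rcases hs with hs | hs
  · exact main _ _ hs hy hc.1 hc.2
  · exact main _ false hs (by rwa [gap_swap]) (by rw [gap_swap]; exact hc.1)
      (by rw [col_swap]; exact hc.2)

end Comb

/-! ### Jankov formulas and p-morphisms -/

section Jankov

variable {F : Type} [PartialOrder F] {W : Type*} [PartialOrder W]

/-- The truth set of `Γ_a → p_a`. -/
def jankovStep (V : F → Set W) (a : F) : Set W :=
  {v | ∀ u, v ≤ u → (∀ c, ¬ a ≤ c → u ∈ V c) → u ∈ V a}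

theorem subset_jankovStep {V : F → Set W} (hV : ∀ a, IsUpperSet (V a)) (a : F) :
    V a ⊆ jankovStep V a :=
  fun _ hv _ hu _ => hV a hu hv

theorem forces_jankovForm [OrderBot F] [Fintype F] (V : F → Set W) (w : W) :
    forces V w (jankovForm F) ↔ ∀ v, w ≤ v →
      (∀ a b, a ≤ b → ∀ u, v ≤ u → u ∈ jankovStep V b → u ∈ V a) →
      (∀ d : Finset F, IsAntichain (· ≤ ·) (d : Set F) → 2 ≤ d.card → ∀ u, v ≤ u →
        (∀ a, (∀ b ∈ d, ¬ b ≤ a) → u ∈ jankovStep V a) → ∃ a ∈ d, u ∈ V a) →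
      (∀ u, v ≤ u → ¬ ∀ a, u ∈ jankovStep V a) → v ∈ V ⊥ := by
  have hdisj : ∀ (d : Finset F) (v : W),
      forces V v (disj (d.toList.map var)) ↔ ∃ a ∈ d, v ∈ V a := fun d v => by
    simp [forces_disj, forces]
  simp only [jankovForm, forces, forces_conj, hdisj, List.forall_mem_map, Finset.mem_toList,
    Finset.mem_filter, Finset.mem_univ, true_and, and_imp, Prod.forall, true_imp_iff, jankovStep,
    Set.mem_ofPred_eq, imp_false]

/-- A refutation of the Jankov formula of `F` yields a p-morphism of a cone onto `F`. -/
theorem exists_pmorphism_of_not_forces_jankovForm [OrderBot F] [Fintype F] {V : F → Set W}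
    (hV : ∀ a, IsUpperSet (V a)) {w : W} (h : ¬ forces V w (jankovForm F)) :
    ∃ v, w ≤ v ∧ ∃ f : W → F, f v = ⊥ ∧ (∀ x y, v ≤ x → x ≤ y → f x ≤ f y) ∧
      ∀ x, v ≤ x → ∀ b, f x ≤ b → ∃ y, x ≤ y ∧ f y = b := by
  classical
  rw [forces_jankovForm] at h
  push Not at h
  obtain ⟨v, hwv, harrow, hclosed, hstep, hv⟩ := h
  have hmem : ∀ u, v ≤ u → ∀ a, u ∈ V a ↔ u ∈ jankovStep V a := fun u hu a =>
    ⟨fun h => subset_jankovStep hV a h, fun h => harrow a a le_rfl u hu h⟩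
  -- The set of `a` with `u ∉ V a` is nonempty and upward closed, and two minimal elements would
  -- contradict `hclosed`. The p-morphism sends `u` to its least element.
  have hprincipal : ∀ u, v ≤ u → ∃ a, ∀ b, u ∉ V b ↔ a ≤ b := by
    intro u hu
    obtain ⟨a₀, ha₀⟩ := hstep u hu
    rw [← hmem u hu] at ha₀
    have hfin : {a | u ∉ V a}.Finite := Set.toFinite _
    have hmin : ∀ b, u ∉ V b → ∃ a ≤ b, Minimal (fun a => u ∉ V a) a := fun b hb =>
      hfin.exists_le_minimal hb
    obtain ⟨a, -, ha⟩ := hmin a₀ ha₀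
    refine ⟨a, fun b => ⟨fun hb => ?_, fun hab hb => ?_⟩⟩
    · by_contra hab
      obtain ⟨c, hcb, hc⟩ := hmin b hb
      let d : Finset F := {x | Minimal (fun a => u ∉ V a) x}
      have hd : ∀ x, x ∈ d ↔ Minimal (fun a => u ∉ V a) x := fun x => by simp [d]
      have hanti : IsAntichain (· ≤ ·) (d : Set F) := fun x hx y hy hxy hle =>
        hxy (((hd y).1 hy).eq_of_le ((hd x).1 hx).prop hle)
      have hcard : 2 ≤ d.card := by
        refine Finset.one_lt_card.2 ⟨a, (hd a).2 ha, c, (hd c).2 hc, ?_⟩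
        rintro rfl
        exact hab hcb
      obtain ⟨x, hx, hxV⟩ := hclosed d hanti hcard u hu fun x hx => by
        rw [← hmem u hu]
        by_contra hxV
        obtain ⟨y, hyx, hy⟩ := hmin x hxV
        exact hx y ((hd y).2 hy) hyx
      exact ((hd x).1 hx).prop hxV
    · exact ha.prop (harrow a b hab u hu ((hmem u hu b).1 hb))
  choose! f hf using hprincipal
  refine ⟨v, hwv, f, ?_, fun x y hx hxy => ?_, fun x hx b hb => ?_⟩
  · exact le_bot_iff.1 ((hf v le_rfl ⊥).1 hv)
  · refine (hf x hx _).1 fun h => ?_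
    exact (hf y (hx.trans hxy) _).2 le_rfl (hV _ hxy h)
  · have hxb := (hf x hx b).2 hb
    rw [hmem x hx] at hxb
    simp only [jankovStep, Set.mem_ofPred_eq, not_forall] at hxb
    obtain ⟨y, hxy, hy, hyb⟩ := hxb
    have hvy := hx.trans hxy
    refine ⟨y, hxy, le_antisymm ((hf y hvy b).1 hyb) ?_⟩
    by_contra hc
    exact (hf y hvy _).2 le_rfl (hy _ hc)

/-- The Jankov formula of `F` is refuted at the root of each cone that is isomorphic to `F`. -/
theorem not_forces_jankovForm [OrderBot F] [Fintype F] (e : F ↪o W)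
    (he : IsUpperSet (Set.range e)) :
    ¬ forces (fun a => {x | ¬ x ≤ e a}) (e ⊥) (jankovForm F) := by
  have hup : ∀ a, IsUpperSet {x | ¬ x ≤ e a} := fun a x y hxy hx hy => hx (hxy.trans hy)
  have hstep : ∀ y a, e y ∈ jankovStep (fun a => {x | ¬ x ≤ e a}) a ↔ ¬ y ≤ a := by
    refine fun y a => ⟨fun h hya => ?_, fun h => subset_jankovStep hup a (by simpa using h)⟩
    exact h (e a) (by simpa using hya) (fun c hc => by simpa using hc) le_rfl
  rw [forces_jankovForm]
  intro h
  have hrange : ∀ u, e ⊥ ≤ u → ∃ y, e y = u := fun u hu => he hu ⟨⊥, rfl⟩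
  refine h (e ⊥) le_rfl ?_ ?_ ?_ le_rfl
  · intro a b hab u hu hub
    obtain ⟨y, rfl⟩ := hrange u hu
    rw [hstep] at hub
    exact fun hya => hub ((e.le_iff_le.1 hya).trans hab)
  · intro d hd hcard u hu h
    obtain ⟨y, rfl⟩ := hrange u hu
    have hy : ∃ b ∈ d, b ≤ y := by
      by_contra! hc
      exact (hstep y y).1 (h y hc) le_rfl
    obtain ⟨b, hb, hby⟩ := hy
    obtain ⟨c, hc, hcb⟩ := Finset.exists_mem_ne hcard b
    exact ⟨c, hc, fun hyc => hd hb hc hcb.symm (hby.trans (e.le_iff_le.1 hyc))⟩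
  · intro u hu
    obtain ⟨y, rfl⟩ := hrange u hu
    exact fun h => (hstep y y).1 (h y) le_rfl

theorem forces_jankov [OrderBot F] [Fintype F] (V : ℕ → Set W) (w : W) :
    forces V w (jankov F) ↔
      forces (fun a => V (Fintype.equivFin F a : ℕ)) w (jankovForm F) :=
  forces_subst V _ _ w

theorem exists_not_forces_jankov [OrderBot F] [Fintype F] (e : F ↪o W)
    (he : IsUpperSet (Set.range e)) :
    ∃ V : ℕ → Set W, (∀ a, IsUpperSet (V a)) ∧ ¬ forces V (e ⊥) (jankov F) := by
  refine ⟨fun n => {x | ∀ a, (Fintype.equivFin F a : ℕ) = n → ¬ x ≤ e a},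
    fun n x y hxy hx a ha hy => hx a ha (hxy.trans hy), fun h => not_forces_jankovForm e he ?_⟩
  rw [forces_jankov] at h
  convert h using 2 with a
  ext x
  refine ⟨fun hx b hb => ?_, fun hx => hx a rfl⟩
  rwa [(Fintype.equivFin F).injective (Fin.ext hb)]

theorem mem_kimp_pmorphism {W' : Type*} [PartialOrder W'] {v : W} {g : W → W'}
    (hmono : ∀ x y, v ≤ x → x ≤ y → g x ≤ g y)
    (hback : ∀ x, v ≤ x → ∀ b, g x ≤ b → ∃ y, x ≤ y ∧ g y = b) {A B : Set W} {A' B' : Set W'}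
    (hA : ∀ x, v ≤ x → (x ∈ A ↔ g x ∈ A')) (hB : ∀ x, v ≤ x → (x ∈ B ↔ g x ∈ B')) (x : W)
    (hx : v ≤ x) : x ∈ kimp A B ↔ g x ∈ kimp A' B' := by
  constructor
  · intro h b hb hbA
    obtain ⟨y, hxy, rfl⟩ := hback x hx b hb
    have hy := hx.trans hxy
    exact (hB y hy).1 (h y hxy ((hA y hy).2 hbA))
  · intro h y hxy hyA
    have hy := hx.trans hxy
    exact (hB y hy).2 (h _ (hmono x y hx hxy) ((hA y hy).1 hyA))

theorem mem_col_pmorphism {W' : Type*} [PartialOrder W'] {v : W} {g : W → W'}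
    (hmono : ∀ x y, v ≤ x → x ≤ y → g x ≤ g y)
    (hback : ∀ x, v ≤ x → ∀ b, g x ≤ b → ∃ y, x ≤ y ∧ g y = b) {X : Bool → Set W}
    {Y : Bool → Set W'} (hXY : ∀ t x, v ≤ x → (x ∈ X t ↔ g x ∈ Y t)) (n : ℕ) (t : Bool) :
    ∀ x, v ≤ x → (x ∈ col X n t ↔ g x ∈ col Y n t) := by
  induction n using Nat.strong_induction_on generalizing t with
  | _ n ih =>
    match n with
    | 0 => exact hXY _
    | 1 => exact mem_kimp_pmorphism hmono hback (hXY _) (hXY _)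
    | n + 2 =>
      exact mem_kimp_pmorphism hmono hback (ih (n + 1) (by omega) _) fun x hx =>
        or_congr (ih (n + 1) (by omega) _ x hx) (ih n (by omega) _ x hx)

theorem mem_gap_pmorphism {W' : Type*} [PartialOrder W'] {v : W} {g : W → W'}
    (hmono : ∀ x y, v ≤ x → x ≤ y → g x ≤ g y)
    (hback : ∀ x, v ≤ x → ∀ b, g x ≤ b → ∃ y, x ≤ y ∧ g y = b) {X : Bool → Set W}
    {Y : Bool → Set W'} (hXY : ∀ t x, v ≤ x → (x ∈ X t ↔ g x ∈ Y t)) (n : ℕ) :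
    ∀ x, v ≤ x → (x ∈ gap X n ↔ g x ∈ gap Y n) :=
  have h := mem_col_pmorphism hmono hback hXY
  mem_kimp_pmorphism hmono hback (fun x hx => and_congr (h _ _ x hx) (h _ _ x hx))
    fun x hx => or_congr (h _ _ x hx) (h _ _ x hx)

end Jankov

/-! ### Jankov formulas of the F_n on the comb -/

namespace Comb

/-- The inclusion of `F_n` into the comb, as the cone of `foot n`. -/
def ofSeqFrame (n : ℕ) : SeqFrame n → Comb :=
  WithBot.recBotCoe (foot n) (WithBot.recBotCoe (tooth n) fun l => lad l.side l.level)

/-- `ofSeqFrame` as an order embedding. -/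
def seqFrameEmbedding (n : ℕ) : SeqFrame n ↪o Comb :=
  OrderEmbedding.ofMapLEIff (ofSeqFrame n) fun a b => by
    have hlad : ∀ l m : Ladder n, l ≤ m ↔
        (l.side = m.side ∧ (m.level : ℕ) ≤ l.level) ∨ (m.level : ℕ) + 2 ≤ l.level :=
      fun _ _ => Iff.rfl
    induction a using WithBot.recBotCoe with
    | bot =>
      induction b using WithBot.recBotCoe with
      | bot => simp
      | coe b =>
        induction b using WithBot.recBotCoe with
        | bot => simp [ofSeqFrame]
        | coe m => simpa [ofSeqFrame] using Nat.lt_succ_iff.1 m.level.isLt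
    | coe a =>
      induction a using WithBot.recBotCoe with
      | bot =>
        induction b using WithBot.recBotCoe with
        | bot => simp [ofSeqFrame]
        | coe b =>
          induction b using WithBot.recBotCoe with
          | bot => simp [ofSeqFrame]
          | coe m => simpa [ofSeqFrame] using Nat.lt_succ_iff.1 m.level.isLt
      | coe l =>
        induction b using WithBot.recBotCoe with
        | bot => simp [ofSeqFrame]
        | coe b =>
          induction b using WithBot.recBotCoe with
          | bot => simp [ofSeqFrame]
          | coe m => simp [ofSeqFrame, hlad]

theorem exists_seqFrameEmbedding_eq {n : ℕ} {x : Comb} (hx : foot n ≤ x) :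
    ∃ a, seqFrameEmbedding n a = x := by
  rcases x with ⟨u, j⟩ | j | j | j
  · exact ⟨((⟨u, ⟨j, by simp at hx; omega⟩⟩ : Ladder n) : WithBot (Ladder n)), rfl⟩
  · obtain rfl : n = j := hx
    exact ⟨((⊥ : WithBot (Ladder n)) : SeqFrame n), rfl⟩
  · obtain rfl : n = j := hx
    exact ⟨⊥, rfl⟩
  · simp at hx

theorem isUpperSet_range_seqFrameEmbedding (n : ℕ) :
    IsUpperSet (Set.range (seqFrameEmbedding n)) := by
  rintro _ y hy ⟨a, rfl⟩
  exact exists_seqFrameEmbedding_eq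
    ((show foot n ≤ seqFrameEmbedding n a from (seqFrameEmbedding n).monotone bot_le).trans hy)

theorem exists_not_forces_jankov_foot (n : ℕ) :
    ∃ V : ℕ → Set Comb, (∀ a, IsUpperSet (V a)) ∧ ¬ forces V (foot n) (jankov (SeqFrame n)) :=
  exists_not_forces_jankov _ (isUpperSet_range_seqFrameEmbedding n)

theorem eq_of_lad_zero_le {t : Bool} {z : Comb} (h : lad t 0 ≤ z) : z = lad t 0 := by
  rcases z with ⟨u, j⟩ | j | j | j <;> simp_all

theorem pattern_Ici : Pattern (fun t => Set.Ici (lad t 0)) 0 where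
  upper _ := isUpperSet_Ici _
  mem _ := Set.self_mem_Ici
  notMem t := by simp
  notMem_succ t := by simp
  below _ _ _ h := by simp at h

/-- For s > 0 the top of the ladder would lie in both sets. -/
theorem Pattern.eq_zero {X : Bool → Set Comb} {s : ℕ} (hP : Pattern X s)
    (hdisj : ∀ x, x ∈ X true → x ∉ X false) : s = 0 := by
  by_contra hs
  exact hdisj _ (hP.below true true 0 (by omega)) (hP.below true false 0 (by omega))

/-- In the comb, the Jankov formula of `F_m` is only refuted at `foot m`. -/
theorem forces_jankov_of_ne {V : ℕ → Set Comb} (hV : ∀ a, IsUpperSet (V a)) {m : ℕ} {x : Comb}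
    (hx : x ≠ foot m) : forces V x (jankov (SeqFrame m)) := by
  rw [forces_jankov]
  by_contra h
  obtain ⟨v, hxv, f, hfv, hmono, hback⟩ :=
    exists_pmorphism_of_not_forces_jankovForm (fun a => hV _) h
  set e := seqFrameEmbedding m
  let g : Comb → Comb := fun y => e (f y)
  have hgv : g v = foot m := by
    show e (f v) = foot m
    rw [hfv]
    rfl
  have hgmono : ∀ x y, v ≤ x → x ≤ y → g x ≤ g y := fun x y hx hxy => e.monotone (hmono x y hx hxy)
  have hgback : ∀ x, v ≤ x → ∀ b, g x ≤ b → ∃ y, x ≤ y ∧ g y = b := by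
    intro x hx b hb
    obtain ⟨a, rfl⟩ := isUpperSet_range_seqFrameEmbedding m hb ⟨_, rfl⟩
    obtain ⟨y, hy, rfl⟩ := hback x hx a (e.le_iff_le.1 hb)
    exact ⟨y, hy, rfl⟩
  let Y : Bool → Set Comb := fun t => Set.Ici (lad t 0)
  -- The condition `v ≤ y` makes these sets upper in the whole comb; `g` is controlled only above
  -- `v`.
  let X : Bool → Set Comb := fun t => {y | v ≤ y ∧ g y ∈ Y t}
  have hXup : ∀ t, IsUpperSet (X t) := fun t y z hyz hy =>
    ⟨hy.1.trans hyz, isUpperSet_Ici _ (hgmono y z hy.1 hyz) hy.2⟩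
  have hdisj : ∀ t y, y ∈ X t → y ∉ X !t := by
    intro t y hy hy'
    have h := (eq_of_lad_zero_le hy.2).symm.trans (eq_of_lad_zero_le hy'.2)
    simp at h
  have hgap : ∀ n y, v ≤ y → (y ∉ gap X n ↔ g y ≤ tooth n) := by
    intro n y hy
    have h := pattern_Ici.notMem_gap_iff (x := g y) n
    rw [zero_add] at h
    rw [← h, mem_gap_pmorphism hgmono hgback (Y := Y) (fun t x hx => by simp [X, hx]) n y hy]
  have hv : v ∉ gap X m := (hgap m v le_rfl).2 (by rw [hgv]; simp)
  -- The pulled-back valuation has a pattern of its own, at s = 0 by disjointness. With `hgap`, a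
  -- point above `v` is below `tooth n` exactly when its image is.
  have hgapX : ∀ n y, y ∉ gap X n ↔ y ≤ tooth n := by
    intro n y
    obtain ⟨s, hs | hs⟩ := exists_pattern hXup hv
    · obtain rfl := hs.eq_zero (hdisj true)
      simpa using hs.notMem_gap_iff (x := y) n
    · obtain rfl := hs.eq_zero (hdisj false)
      rw [← gap_swap]
      simpa using hs.notMem_gap_iff (x := y) n
  have h₁ : v ≤ tooth m := (hgapX m v).1 hv
  have h₂ : ¬ v ≤ tooth (m + 1) := fun h => by
    have := (hgap (m + 1) v le_rfl).1 ((hgapX _ _).2 h)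
    rw [hgv] at this
    simp at this
  rcases v with ⟨u, j⟩ | j | j | j
  · simp at h₁
  · obtain rfl : j = m := h₁
    -- A preimage of the tooth above `v = tooth j` is also below `tooth j`, so it is `v`, whose
    -- image is the foot.
    obtain ⟨y, hy, hgy⟩ := hgback (tooth j) le_rfl (tooth j) (by rw [hgv]; simp)
    have hy' : y ≤ tooth j := (hgapX j y).1 ((hgap j y hy).2 hgy.le)
    rw [le_antisymm hy' hy, hgv] at hgy
    cases hgy
  · obtain rfl : j = m := h₁
    exact hx (eq_foot_of_le hxv)
  · simp at h₁ h₂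
    omega

/-! ### The formula bb₂ on the comb -/

section GabbayDeJongh

variable {V : ℕ → Set Comb}

/-- The antecedent of `bb₂` at a point. -/
def Covers (V : ℕ → Set Comb) (w : Comb) : Prop :=
  ∀ i < 3, ∀ u, w ≤ u →
    (∀ x, u ≤ x → x ∈ V i → ∃ j < 3, j ≠ i ∧ x ∈ V j) → ∃ j < 3, j ≠ i ∧ u ∈ V j

theorem Covers.mono {v w : Comb} (hw : Covers V w) (h : w ≤ v) : Covers V v :=
  fun i hi u hu => hw i hi u (h.trans hu)

/-- Two of the three indices cover everything strictly above `w`. If `w` were in no `V i`, the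
premise for the third index would hold at `w` and put it into another set. -/
theorem Covers.mem_of_succ {w : Comb} (hV : ∀ a, IsUpperSet (V a)) (hw : Covers V w)
    (y₁ y₂ : Comb) (hy : ∀ z, w < z → (w < y₁ ∧ y₁ ≤ z) ∨ (w < y₂ ∧ y₂ ≤ z))
    (hQ : ∀ y, w < y → ∃ i < 3, y ∈ V i) : ∃ i < 3, w ∈ V i := by
  have hch : ∀ y, ∃ i < 3, w < y → y ∈ V i := fun y => by
    by_cases h : w < y
    · obtain ⟨i, hi, h'⟩ := hQ y h
      exact ⟨i, hi, fun _ => h'⟩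
    · exact ⟨0, by omega, fun h' => (h h').elim⟩
  obtain ⟨i₁, hi₁, h₁⟩ := hch y₁
  obtain ⟨i₂, hi₂, h₂⟩ := hch y₂
  obtain ⟨i, hi, hne₁, hne₂⟩ : ∃ i < 3, i₁ ≠ i ∧ i₂ ≠ i := by
    by_contra! hc
    have := hc 0
    have := hc 1
    have := hc 2
    omega
  by_contra! hc
  obtain ⟨j, hj, -, h⟩ := hw i hi w le_rfl fun x hx hxi => by
    rcases hx.eq_or_lt with rfl | hlt
    · exact (hc i hi hxi).elim
    · rcases hy x hlt with h | h
      · exact ⟨i₁, hi₁, hne₁, hV _ h.2 (h₁ h.1)⟩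
      · exact ⟨i₂, hi₂, hne₂, hV _ h.2 (h₂ h.1)⟩
  exact hc j hj h

theorem Covers.mem_lad (hV : ∀ a, IsUpperSet (V a)) (t : Bool) (i : ℕ)
    (hw : Covers V (lad t i)) : ∃ k < 3, lad t i ∈ V k := by
  induction i using Nat.strong_induction_on generalizing t with
  | _ i ih =>
    -- For i < 2 truncated subtraction yields points not above `lad t i`; the conditions `w < y₁`
    -- and `w < y₂` in `mem_of_succ` discard them.
    refine hw.mem_of_succ hV (lad t (i - 1)) (lad (!t) (i - 2)) ?_ ?_
    · intro z hz
      rw [lt_iff_le_and_ne] at hz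
      rcases z with ⟨u, j⟩ | j | j | j <;>
        simp only [lt_iff_le_and_ne, lad_le_lad, lad_le_tooth, lad_le_foot, lad_le_spine, ne_eq,
          lad.injEq, false_and] at hz ⊢
      cases t <;> cases u <;> simp at hz ⊢ <;> omega
    · intro z hz
      have hw' := hw.mono hz.le
      rw [lt_iff_le_and_ne] at hz
      rcases z with ⟨u, j⟩ | j | j | j <;>
        simp only [lad_le_lad, lad_le_tooth, lad_le_foot, lad_le_spine, ne_eq,
          lad.injEq, false_and] at hz
      exact ih j (by grind) u hw'

theorem Covers.mem_tooth (hV : ∀ a, IsUpperSet (V a)) (n : ℕ) (hw : Covers V (tooth n)) :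
    ∃ k < 3, tooth n ∈ V k := by
  refine hw.mem_of_succ hV (lad true (n + 1)) (lad false (n + 1)) ?_ ?_
  · intro z hz
    rw [lt_iff_le_and_ne] at hz
    rcases z with ⟨u, j⟩ | j | j | j <;> simp_all [lt_iff_le_and_ne]
    cases u <;> simp
  · intro z hz
    have hw' := hw.mono hz.le
    rw [lt_iff_le_and_ne] at hz
    rcases z with ⟨u, j⟩ | j | j | j
    · exact hw'.mem_lad hV u j
    all_goals simp_all

theorem Covers.mem_foot (hV : ∀ a, IsUpperSet (V a)) (n : ℕ) (hw : Covers V (foot n)) :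
    ∃ k < 3, foot n ∈ V k := by
  refine hw.mem_of_succ hV (tooth n) (tooth n) ?_ ?_
  · intro z hz
    rw [lt_iff_le_and_ne] at hz
    rcases z with ⟨u, j⟩ | j | j | j <;> simp_all [lt_iff_le_and_ne]
  · intro z hz
    have hw' := hw.mono hz.le
    rw [lt_iff_le_and_ne] at hz
    rcases z with ⟨u, j⟩ | j | j | j
    · exact hw'.mem_lad hV u j
    · exact hw'.mem_tooth hV j
    all_goals simp_all

-- Once some spine point is covered, the ones below it follow by descent. Otherwise almost all teeth
-- lie in one `V i`, so far up the spine every other `V i'` is contained in `V i`; the premise for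
-- `i'` then covers a spine point after all.
open Filter in
theorem Covers.mem_spine (hV : ∀ a, IsUpperSet (V a))
    (hev : ∀ a, (∀ᶠ n in atTop, tooth n ∈ V a) ∨ ∀ᶠ n in atTop, tooth n ∉ V a) (m : ℕ)
    (hw : Covers V (spine m)) : ∃ k < 3, spine m ∈ V k := by
  by_cases hex : ∃ j, m ≤ j ∧ ∃ k < 3, spine j ∈ V k
  · obtain ⟨j, hmj, hj⟩ := hex
    induction j, hmj using Nat.le_induction with
    | base => exact hj
    | succ j hmj ih =>
      refine ih ((hw.mono (v := spine j) hmj).mem_of_succ hV (tooth j) (spine (j + 1)) ?_ ?_)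
      · intro z hz
        rw [lt_iff_le_and_ne] at hz
        rcases z with ⟨u, k⟩ | k | k | k <;> simp [lt_iff_le_and_ne] at hz ⊢ <;> omega
      · intro z hz
        have hw' := hw.mono ((show spine m ≤ spine j from hmj).trans hz.le)
        rw [lt_iff_le_and_ne] at hz
        rcases z with ⟨u, k⟩ | k | k | k
        · exact hw'.mem_lad hV u k
        · exact hw'.mem_tooth hV k
        · exact hw'.mem_foot hV k
        · obtain ⟨i, hi, h⟩ := hj
          refine ⟨i, hi, hV _ ?_ h⟩
          simp at hz ⊢
          omega
  · push Not at hex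
    exfalso
    obtain ⟨i, hi, N, hN⟩ : ∃ i < 3, ∃ N, ∀ n, N ≤ n → tooth n ∈ V i := by
      by_contra! hc
      have hfin : ∀ i < 3, ∀ᶠ n in atTop, tooth n ∉ V i := fun i hi =>
        (hev i).resolve_left fun h => by
          obtain ⟨N, hN⟩ := eventually_atTop.1 h
          obtain ⟨n, hn, hn'⟩ := hc i hi N
          exact hn' (hN n hn)
      obtain ⟨n, hn, h₀, h₁, h₂⟩ := ((eventually_ge_atTop m).and ((hfin 0 (by omega)).and
        ((hfin 1 (by omega)).and (hfin 2 (by omega))))).exists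
      obtain ⟨k, hk, h⟩ := (hw.mono (v := tooth n) hn).mem_tooth hV n
      interval_cases k <;> contradiction
    obtain ⟨i', hi', hne⟩ : ∃ i' < 3, i ≠ i' :=
      ⟨(i + 1) % 3, Nat.mod_lt _ (by omega), by omega⟩
    obtain ⟨k, hk, -, h⟩ := hw i' hi' (spine (max m N)) (by simp) fun z hz hzi => by
      refine ⟨i, hi, hne, ?_⟩
      rcases z with ⟨u, k⟩ | k | k | k
      · exact hV _ (by simp; omega) (hN (max N k) (le_max_left _ _))
      · simp at hz
        exact hN k hz.2
      · simp at hz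
      · simp at hz
        exact (hex k hz.1 i' hi' hzi).elim
    exact hex _ (le_max_left _ _) k hk h

end GabbayDeJongh

/-! ### The general frame and the underivable formulas -/

/-- The family of the upper sets that contain almost all or almost no teeth. -/
def admissible : Set (Set Comb) :=
  {A | IsUpperSet A ∧
    ((∀ᶠ n in Filter.atTop, tooth n ∈ A) ∨ ∀ᶠ n in Filter.atTop, tooth n ∉ A)}

theorem isAdmissible_admissible : IsAdmissible admissible where
  upper _ h := h.1
  empty := ⟨isUpperSet_empty, Or.inr (by simp)⟩
  inter A hA B hB := by
    refine ⟨hA.1.inter hB.1, ?_⟩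
    rcases hA.2 with h | h
    · rcases hB.2 with h' | h'
      · exact Or.inl (by filter_upwards [h, h'] with n h h' using ⟨h, h'⟩)
      · exact Or.inr (by filter_upwards [h'] with n h using fun h' => h h'.2)
    · exact Or.inr (by filter_upwards [h] with n h using fun h' => h h'.1)
  union A hA B hB := by
    refine ⟨hA.1.union hB.1, ?_⟩
    rcases hA.2 with h | h
    · exact Or.inl (by filter_upwards [h] with n h using Or.inl h)
    · rcases hB.2 with h' | h'
      · exact Or.inl (by filter_upwards [h'] with n h using Or.inr h)
      · exact Or.inr (by filter_upwards [h, h'] with n h h' using fun h'' => h''.elim h h')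
  kimp A hA B hB := by
    refine ⟨isUpperSet_kimp _ _, ?_⟩
    -- A ladder point in `A` but not in `B` is seen by almost all teeth. Without one, membership of
    -- a tooth in `kimp A B` is decided at the tooth itself.
    by_cases hlad : ∀ t j, lad t j ∈ A → lad t j ∈ B
    · have hiff : ∀ n, tooth n ∈ kimp A B ↔ (tooth n ∈ A → tooth n ∈ B) := by
        refine fun n => ⟨fun h => h _ le_rfl, fun h z hz => ?_⟩
        rcases z with ⟨u, j⟩ | j | j | j
        · exact hlad u j
        · obtain rfl : n = j := hz
          exact h
        all_goals simp at hz
      simp only [hiff]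
      rcases hB.2 with h | h
      · exact Or.inl (by filter_upwards [h] with n h using fun _ => h)
      · rcases hA.2 with h' | h'
        · exact Or.inr (by filter_upwards [h, h'] with n h h' using fun h'' => h (h'' h'))
        · exact Or.inl (by filter_upwards [h'] with n h using fun h'' => (h h'').elim)
    · push Not at hlad
      obtain ⟨t, j, hA, hB⟩ := hlad
      refine Or.inr ?_
      filter_upwards [Filter.eventually_ge_atTop j] with n hn h
      exact hB (h (lad t j) (by simp; omega) hA)

theorem forces_bb_two_of_mem_admissible {V : ℕ → Set Comb} (hV : ∀ a, V a ∈ admissible)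
    (x : Comb) : forces V x (bb 2) := by
  rw [forces_bb_two]
  intro v _ hv
  have hup : ∀ a, IsUpperSet (V a) := fun a => (hV a).1
  rcases v with ⟨u, j⟩ | j | j | j
  · exact Covers.mem_lad hup u j hv
  · exact Covers.mem_tooth hup j hv
  · exact Covers.mem_foot hup j hv
  · exact Covers.mem_spine hup (fun a => (hV a).2) j hv

/-- No spine point lies above a foot, so arbitrary upper sets are allowed here. -/
theorem forces_bb_two_of_foot_le {V : ℕ → Set Comb} (hV : ∀ a, IsUpperSet (V a)) {n : ℕ}
    {x : Comb} (hx : foot n ≤ x) : forces V x (bb 2) := by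
  rw [forces_bb_two]
  intro v hv hc
  rcases v with ⟨u, j⟩ | j | j | j
  · exact Covers.mem_lad hV u j hc
  · exact Covers.mem_tooth hV j hc
  · exact Covers.mem_foot hV j hc
  · simpa using hx.trans hv

theorem forces_of_mem_shLogic {S : Set ℕ} {𝒜 : Set (Set Comb)} (h𝒜 : IsAdmissible 𝒜) {x : Comb}
    (hbb : ∀ V : ℕ → Set Comb, (∀ a, V a ∈ 𝒜) → forces V x (bb 2)) (hx : ∀ n ∈ S, x ≠ foot n)
    {φ : Form ℕ} (hφ : φ ∈ shLogic S) {V : ℕ → Set Comb} (hV : ∀ a, V a ∈ 𝒜) :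
    forces V x φ := by
  refine h𝒜.forces_of_derivable x ?_ hφ V hV
  rintro φ ((rfl | rfl | rfl) | ⟨n, hn, rfl⟩) V hV
  · exact forces_shDelta_comb (fun a => h𝒜.upper _ (hV a)) x
  · exact forces_shKappa_comb (fun a => h𝒜.upper _ (hV a)) x
  · exact hbb V hV
  · exact forces_jankov_of_ne (fun a => h𝒜.upper _ (hV a)) (hx n hn)

theorem jankov_notMem_shLogic {S : Set ℕ} {n : ℕ} (hn : n ∉ S) :
    jankov (SeqFrame n) ∉ shLogic S := by
  intro h
  obtain ⟨V, hV, hnV⟩ := exists_not_forces_jankov_foot n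
  refine hnV (forces_of_mem_shLogic (isAdmissible_isUpperSet Comb)
    (fun V hV => forces_bb_two_of_foot_le hV le_rfl) ?_ h hV)
  intro m hm hnm
  cases hnm
  exact hn hm

theorem shEpsilon_notMem_shLogic (S : Set ℕ) : shEpsilon ∉ shLogic S := by
  intro h
  let X : Bool → Set Comb := fun t => Set.Ici (lad t 0)
  let V : ℕ → Set Comb := fun a => X (decide (a = 1))
  have hV : ∀ a, V a ∈ admissible := fun a =>
    ⟨isUpperSet_Ici _, Or.inr (Filter.Eventually.of_forall fun n => by simp [V, X])⟩
  have hVX : valPair V = X := funext fun t => by cases t <;> rfl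
  have hforces := forces_of_mem_shLogic isAdmissible_admissible (x := spine 0)
    (fun V hV => forces_bb_two_of_mem_admissible hV _) (fun n _ h => by cases h) h hV
  simp only [shEpsilon, forces, forces_shAlpha, hVX] at hforces
  rcases hforces with h | h
  · exact (pattern_Ici.notMem_gap_iff 0).2 (by simp) h
  · exact (pattern_Ici.notMem_gap_iff 1).2 (by simp) h

end Comb

/-! ### The theorem -/

theorem Derivable.mono {Γ Δ : Set (Form ℕ)} (h : Γ ⊆ Δ) {φ : Form ℕ} (hφ : Derivable Γ φ) :
    Derivable Δ φ := by
  induction hφ with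
  | ax hφ => exact .ax (h hφ)
  | imp_k φ ψ => exact .imp_k φ ψ
  | imp_s φ ψ χ => exact .imp_s φ ψ χ
  | and_left φ ψ => exact .and_left φ ψ
  | and_right φ ψ => exact .and_right φ ψ
  | and_intro φ ψ => exact .and_intro φ ψ
  | or_left φ ψ => exact .or_left φ ψ
  | or_right φ ψ => exact .or_right φ ψ
  | or_elim φ ψ χ => exact .or_elim φ ψ χ
  | bot_elim φ => exact .bot_elim φ
  | mp _ _ ih₁ ih₂ => exact .mp ih₁ ih₂
  | subst σ _ ih => exact .subst σ ih

theorem isIntermediateLogic_shLogic (S : Set ℕ) : IsIntermediateLogic (shLogic S) where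
  int_subset _ h := Derivable.mono (Set.empty_subset _) h
  subset_classical φ h v := by
    -- Constant valuations turn forcing into classical truth; any point above a foot that is not
    -- itself a foot would do.
    refine (forces_const v φ (Comb.lad true 0)).1 ?_
    refine Comb.forces_of_mem_shLogic (isAdmissible_isUpperSet Comb)
      (fun V hV => Comb.forces_bb_two_of_foot_le (n := 0) hV (by simp)) (fun n _ h => by cases h) h ?_
    exact fun a _ _ _ h => h
  mp _ _ h₁ h₂ := Derivable.mp h₁ h₂
  subst _ σ h := Derivable.subst σ h

theorem shLogic_injective : Function.Injective shLogic := by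
  have key : ∀ S T : Set ℕ, shLogic S = shLogic T → S ⊆ T := by
    intro S T h n hn
    by_contra hnT
    refine Comb.jankov_notMem_shLogic hnT ?_
    rw [← h]
    exact Derivable.ax (Or.inr ⟨n, hn, rfl⟩)
  exact fun S T h => (key S T h).antisymm (key T S h.symm)

theorem not_kripkeComplete_shLogic (S : Set ℕ) : ¬ KripkeComplete.{u} (shLogic S) := by
  rintro ⟨C, hC⟩
  refine Comb.shEpsilon_notMem_shLogic S ((hC _).2 fun W hW => ?_)
  refine validIn_shEpsilon ((hC _).1 (Derivable.ax ?_) W hW) ((hC _).1 (Derivable.ax ?_) W hW)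
    ((hC _).1 (Derivable.ax ?_) W hW)
  all_goals simp

theorem theoremt :
    (∀ S : Set ℕ, IsIntermediateLogic (shLogic S)) ∧
    (∀ S T : Set ℕ, S ≠ T → shLogic S ≠ shLogic T) ∧
    Cardinal.mk (Set.range shLogic) = Cardinal.continuum ∧
    ∀ S : Set ℕ, ¬ KripkeComplete.{u} (shLogic S) := by
  refine ⟨isIntermediateLogic_shLogic, fun S T h h' => h (shLogic_injective h'), ?_,
    not_kripkeComplete_shLogic⟩
  rw [Cardinal.mk_range_eq _ shLogic_injective, Cardinal.mk_set, Cardinal.mk_nat,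
    Cardinal.two_power_aleph0]
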